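/- Let $M$ be a non-empty smooth manifold of dimension $2n+s$ with $n,s\ge 1$. A weak metric $f$-structure $(f,Q,\vec\xi,\vec\eta,g)$ on $M$ consists of a Riemannian metric $g$, a $g$-skew-symmetric $(1,1)$-tensor $f$ of rank $2n$, a self-adjoint nonsingular $(1,1)$-tensor $Q$, orthonormal vector fields $\vec\xi=(\xi_1,\dots,\xi_s)$ and dual 1-forms $\vec\eta=(\eta^1,\dots,\eta^s)$ (all smooth) with $$f^2=-Q+\sum_{i=1}^s\eta^i\otimes\xi_i,\qquad \eta^i(\xi_j)=\delta^i_j,\qquad Q\xi_i=\xi_i,\qquad g(fX,fY)=g(X,QY)-\sum_{i=1}^s\eta^i(X)\eta^i(Y).$$ It is a weak nearly $\mathcal C$-structure if $(\nabla_Xf)Y+(\nabla_Yf)X=0$ for all $X,Y$, where $\nabla$ is the Levi-Civita connection of $g$. Put $\mathcal D=\bigcap_{i}\ker\eta^i$, $\widetilde Q=Q-\mathrm{id}$, $R_{X,Y}=[\nabla_X,\nabla_Y]-\nabla_{[X,Y]}$, $R_{\xi_i}X=R_{X,\xi_i}\xi_i$, and $d\eta(X,Y)=X(\eta(Y))-Y(\eta(X))-\eta([X,Y])$.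 A weak metric $f$-structure $(f,Q,\vec\xi,\vec\eta,g)$ is a weak $f$-K-contact structure if every $\xi_i$ is Killing and $g(X,fY)=\tfrac12\,d\eta^i(X,Y)$ for all $X,Y$ and $i$ (that is, the fundamental form equals the exterior derivative of each $\eta^i$ in the normalization with the factor $\tfrac12$). The coframe $\{\eta^i\}$ is uniform if it defines a uniform $s$-contact structure, that is: the $\eta^i$ are pointwise linearly independent; there is a splitting $TM=\mathcal R\oplus\mathcal D$ such that, for every $i$, $d\eta^i|_{\mathcal D}$ is non-degenerate and $\ker d\eta^i=\mathcal R$; and $d\eta^i=d\eta^j$ for all $i,j$. **Theorem.** Let $(f,Q,\vec\xi,\vec\eta,g)$ be a weak nearly $\mathcal C$-structure on $M^{2n+s}$ such that $$[\xi_i,\xi_j]=0,\qquad g(\nabla_X\xi_i,\xi_j)=0\quad(X\in TM,\ 1\le i,j\le s),$$ $$(\nabla_XQ)Y=0\quad(X\in TM,\ Y\in\mathcal D),\qquad R_{\widetilde QX,Y}Z\in\mathcal D\quad(X,Y,Z\in\mathcal D).$$ If the coframe $\{\eta^i\}$ is uniform, then $n=2$, so that $\dim M=4+s$, and $M$ admits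 a weak $f$-K-contact structure $(\hat f,\hat Q,\vec\xi,\vec\eta,g)$ with $\hat fX=-\nabla_X\xi_i$ for all $X\in TM$ and $\hat QX=R_{\xi_i}X$ for all $X\in\mathcal D$, for every $i=1,\dots,s$. -/

import Mathlib

open Bundle Manifold FiberBundle
open scoped ContDiff

namespace WeakNearlyC

noncomputable section LeviCivita

set_option linter.unusedSectionVars false

variable {E : Type*} [NormedAddCommGroup E] [NormedSpace ℝ E] [FiniteDimensional ℝ E]
  {H : Type*} [TopologicalSpace H] {I : ModelWithCorners ℝ E H}
  {M : Type*} [TopologicalSpace M] [ChartedSpace H M] [IsManifold I ∞ M]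
  (g : ContMDiffRiemannianMetric I ∞ E (fun x : M ↦ TangentSpace I x))

theorem mdifferentiableAt_metric {X Y : Π x : M, TangentSpace I x} {x : M}
    (hX : MDiffAt (T% X) x) (hY : MDiffAt (T% Y) x) :
    MDiffAt (fun y ↦ g.inner y (X y) (Y y)) x := by
  have hg := (g.contMDiff x).mdifferentiableAt (by simp)
  have h : MDifferentiableAt I (I.prod 𝓘(ℝ, ℝ))
      (fun m ↦ TotalSpace.mk' ℝ (E := Bundle.Trivial M ℝ) m (g.inner m (X m) (Y m))) x :=
    MDifferentiableAt.clm_bundle_apply₂ (F₁ := E) (F₂ := E) hg hX hY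
  simp only [mdifferentiableAt_totalSpace] at h
  exact h.2

/-- The right-hand side of the Koszul formula: `koszul g Y X Z = 2 g(∇_X Y, Z)`, that is,
`X g(Y,Z) + Y g(X,Z) - Z g(X,Y) + g([X,Y],Z) - g([X,Z],Y) - g([Y,Z],X)`. -/
def koszul (Y X Z : Π x : M, TangentSpace I x) (x : M) : ℝ :=
  mvfderiv I (fun y ↦ g.inner y (Y y) (Z y)) x (X x)
    + mvfderiv I (fun y ↦ g.inner y (X y) (Z y)) x (Y x)
    - mvfderiv I (fun y ↦ g.inner y (X y) (Y y)) x (Z x)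
    + g.inner x (VectorField.mlieBracket I X Y x) (Z x)
    - g.inner x (VectorField.mlieBracket I X Z x) (Y x)
    - g.inner x (VectorField.mlieBracket I Y Z x) (X x)

theorem koszul_tensorial₁ {Y : Π x : M, TangentSpace I x} {x : M} (hY : MDiffAt (T% Y) x)
    (Z : Π x : M, TangentSpace I x) (hZ : MDiffAt (T% Z) x) :
    TensorialAt I E (fun X ↦ koszul g Y X Z x) x where
  smul {φ X} hφ hX := by
    have h1 := VectorField.mlieBracket_smul_left (I := I) (W := Y) hφ hX
    have h2 := VectorField.mlieBracket_smul_left (I := I) (W := Z) hφ hX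
    have h3 := mvfderiv_fun_mul hφ (mdifferentiableAt_metric g hX hZ)
    have h4 := mvfderiv_fun_mul hφ (mdifferentiableAt_metric g hX hY)
    simp [koszul, h1, h2, h3, h4]
    ring
  add {X X'} hX hX' := by
    have h1 := VectorField.mlieBracket_add_left (I := I) (W := Y) hX hX'
    have h2 := VectorField.mlieBracket_add_left (I := I) (W := Z) hX hX'
    have h3 := mvfderiv_fun_add (mdifferentiableAt_metric g hX hZ)
      (mdifferentiableAt_metric g hX' hZ)
    have h4 := mvfderiv_fun_add (mdifferentiableAt_metric g hX hY)
      (mdifferentiableAt_metric g hX' hY)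
    simp [koszul, h1, h2, h3, h4]
    ring

theorem koszul_tensorial₂ {Y : Π x : M, TangentSpace I x} {x : M} (hY : MDiffAt (T% Y) x)
    (X : Π x : M, TangentSpace I x) (hX : MDiffAt (T% X) x) :
    TensorialAt I E (fun Z ↦ koszul g Y X Z x) x where
  smul {φ Z} hφ hZ := by
    have h1 := VectorField.mlieBracket_smul_right (I := I) (V := X) hφ hZ
    have h2 := VectorField.mlieBracket_smul_right (I := I) (V := Y) hφ hZ
    have h3 := mvfderiv_fun_mul hφ (mdifferentiableAt_metric g hX hZ)
    have h4 := mvfderiv_fun_mul hφ (mdifferentiableAt_metric g hY hZ)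
    simp [koszul, h1, h2, h3, h4]
    rw [g.symm x (Z x) (Y x), g.symm x (Z x) (X x)]
    ring
  add {Z Z'} hZ hZ' := by
    have h1 := VectorField.mlieBracket_add_right (I := I) (V := X) hZ hZ'
    have h2 := VectorField.mlieBracket_add_right (I := I) (V := Y) hZ hZ'
    have h3 := mvfderiv_fun_add (mdifferentiableAt_metric g hX hZ)
      (mdifferentiableAt_metric g hX hZ')
    have h4 := mvfderiv_fun_add (mdifferentiableAt_metric g hY hZ)
      (mdifferentiableAt_metric g hY hZ')
    simp [koszul, h1, h2, h3, h4]
    ring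

open Classical in
/-- `nablaFun g Y x u` is `∇_u Y`, obtained from the Koszul formula by inverting
`g_x : T_xM → T_x^*M` (and `0` where the vector field `Y` is not differentiable). -/
def nablaFun (Y : Π x : M, TangentSpace I x) (x : M) : TangentSpace I x →L[ℝ] TangentSpace I x :=
  if hY : MDiffAt (T% Y) x then
    (1 / 2 : ℝ) • ((g.inner x).inverse ∘L
      TensorialAt.mkHom₂ (I := I) (F := E) (F' := E) (fun X Z ↦ koszul g Y X Z x) x
        (koszul_tensorial₁ g hY) (koszul_tensorial₂ g hY))
  else 0

theorem isInvertible_of_pos (B : E →L[ℝ] E →L[ℝ] ℝ) (h : ∀ v, v ≠ 0 → 0 < B v v) :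
    B.IsInvertible := by
  have hinj : Function.Injective B.toLinearMap := by
    rw [← LinearMap.ker_eq_bot, LinearMap.ker_eq_bot']
    intro v hv
    by_contra hne
    have := h v hne
    simp_all
  have hfr : Module.finrank ℝ E = Module.finrank ℝ (E →L[ℝ] ℝ) := by
    rw [← (LinearMap.toContinuousLinearMap (𝕜 := ℝ) (E := E) (F' := ℝ)).finrank_eq]
    exact (Subspace.dual_finrank_eq).symm
  refine ⟨(LinearEquiv.ofInjectiveOfFinrankEq B.toLinearMap hinj hfr).toContinuousLinearEquiv, ?_⟩
  ext v w
  rfl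

theorem isInvertible_metric (x : M) : (g.inner x).IsInvertible :=
  isInvertible_of_pos (E := E) (g.inner x) (g.pos x)

theorem metric_nondegenerate {x : M} {u v : TangentSpace I x}
    (h : ∀ w, g.inner x u w = g.inner x v w) : u = v := by
  obtain ⟨e, he⟩ := isInvertible_metric g x
  apply e.injective
  ext w
  have := h w
  rw [← he] at this
  simpa using this

theorem metric_nablaFun {Y : Π x : M, TangentSpace I x} {x : M} (hY : MDiffAt (T% Y) x)
    {X Z : Π x : M, TangentSpace I x} (hX : MDiffAt (T% X) x) (hZ : MDiffAt (T% Z) x) :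
    2 * g.inner x (nablaFun g Y x (X x)) (Z x) = koszul g Y X Z x := by
  have h := TensorialAt.mkHom₂_apply (koszul_tensorial₁ g hY) (koszul_tensorial₂ g hY) hX hZ
  rw [nablaFun, dif_pos hY]
  simp only [smul_apply, ContinuousLinearMap.comp_apply, map_smul]
  rw [(isInvertible_metric g x).self_apply_inverse, h]
  simp

theorem nablaFun_add {Y Y' : Π x : M, TangentSpace I x} {x : M} (hY : MDiffAt (T% Y) x)
    (hY' : MDiffAt (T% Y') x) : nablaFun g (Y + Y') x = nablaFun g Y x + nablaFun g Y' x := by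
  ext u
  apply metric_nondegenerate g
  intro w
  have hu := mdifferentiableAt_extend I E u
  have hw := mdifferentiableAt_extend I E w
  have a := metric_nablaFun g hY hu hw
  have b := metric_nablaFun g hY' hu hw
  have c := metric_nablaFun g (mdifferentiableAt_add_section hY hY') hu hw
  have h1 := VectorField.mlieBracket_add_left (I := I) (W := extend E w) hY hY'
  have h2 := VectorField.mlieBracket_add_right (I := I) (V := extend E u) hY hY'
  have h3 := mvfderiv_fun_add (mdifferentiableAt_metric g hY hw)
    (mdifferentiableAt_metric g hY' hw)
  have h4 := mvfderiv_fun_add (mdifferentiableAt_metric g hu hY)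
    (mdifferentiableAt_metric g hu hY')
  simp only [koszul, extend_apply_self] at a b c
  simp [h1, h2, h3, h4] at c
  simp
  linear_combination (c - a - b) / 2

theorem nablaFun_leibniz {Y : Π x : M, TangentSpace I x} {φ : M → ℝ} {x : M}
    (hY : MDiffAt (T% Y) x) (hφ : MDiffAt φ x) :
    nablaFun g (φ • Y) x = φ x • nablaFun g Y x + (mvfderiv I φ x).smulRight (Y x) := by
  ext u
  apply metric_nondegenerate g
  intro w
  have hu := mdifferentiableAt_extend I E u
  have hw := mdifferentiableAt_extend I E w
  have a := metric_nablaFun g hY hu hw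
  have c := metric_nablaFun g (hφ.smul_section hY) hu hw
  have h1 := VectorField.mlieBracket_smul_left (I := I) (W := extend E w) hφ hY
  have h2 := VectorField.mlieBracket_smul_right (I := I) (V := extend E u) hφ hY
  have h3 := mvfderiv_fun_mul hφ (mdifferentiableAt_metric g hY hw)
  have h4 := mvfderiv_fun_mul hφ (mdifferentiableAt_metric g hu hY)
  simp only [koszul, extend_apply_self] at a c
  simp [h1, h2, h3, h4] at c
  simp
  rw [g.symm x u (Y x)] at c
  linear_combination c / 2 - φ x * a / 2

/-- The Levi-Civita connection of `g`; `leviCivita g Y x u` is `∇_u Y` at `x`. -/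
def leviCivita : CovariantDerivative I E (fun x : M ↦ TangentSpace I x) where
  toFun := nablaFun g
  isCovariantDerivativeOnUniv :=
    { add := fun hY hY' _ ↦ nablaFun_add g hY hY'
      leibniz := fun hY hφ _ ↦ nablaFun_leibniz g hY hφ }

theorem leviCivita_metric {X Y Z : Π x : M, TangentSpace I x} {x : M} (hX : MDiffAt (T% X) x)
    (hY : MDiffAt (T% Y) x) (hZ : MDiffAt (T% Z) x) :
    mvfderiv I (fun y ↦ g.inner y (Y y) (Z y)) x (X x) =
      g.inner x (leviCivita g Y x (X x)) (Z x) + g.inner x (Y x) (leviCivita g Z x (X x)) := by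
  have a := metric_nablaFun g hY hX hZ
  have b := metric_nablaFun g hZ hX hY
  rw [g.symm x (Y x)]
  have hs : (fun y ↦ g.inner y (Z y) (Y y)) = fun y ↦ g.inner y (Y y) (Z y) :=
    funext fun y ↦ g.symm y _ _
  have ht := VectorField.mlieBracket_swap_apply (I := I) (V := Z) (W := Y) (x := x)
  simp only [koszul, hs, ht, map_neg, neg_apply] at a b
  change _ = g.inner x (nablaFun g Y x (X x)) (Z x) + g.inner x (nablaFun g Z x (X x)) (Y x)
  linear_combination -(a + b) / 2

theorem leviCivita_torsion {X Y : Π x : M, TangentSpace I x} {x : M} (hX : MDiffAt (T% X) x)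
    (hY : MDiffAt (T% Y) x) :
    leviCivita g Y x (X x) - leviCivita g X x (Y x) = VectorField.mlieBracket I X Y x := by
  apply metric_nondegenerate g
  intro w
  have hw := mdifferentiableAt_extend I E w
  have a := metric_nablaFun g hY hX hw
  have b := metric_nablaFun g hX hY hw
  have hs : (fun y ↦ g.inner y (Y y) (X y)) = fun y ↦ g.inner y (X y) (Y y) :=
    funext fun y ↦ g.symm y _ _
  have ht := VectorField.mlieBracket_swap_apply (I := I) (V := Y) (W := X) (x := x)
  simp only [koszul, hs, ht, map_neg, neg_apply, extend_apply_self] at a b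
  change g.inner x (nablaFun g Y x (X x) - nablaFun g X x (Y x)) w = _
  simp only [map_sub, sub_apply]
  linear_combination (a - b) / 2

end LeviCivita

noncomputable section Structures

set_option linter.unusedSectionVars false

variable {E : Type*} [NormedAddCommGroup E] [NormedSpace ℝ E] [FiniteDimensional ℝ E]
  {H : Type*} [TopologicalSpace H] {I : ModelWithCorners ℝ E H}
  {M : Type*} [TopologicalSpace M] [ChartedSpace H M] [IsManifold I ∞ M]

/-! ### Smooth tensor fields -/

/-- The vector field `X` is smooth. -/
def IsSmoothField (X : Π x : M, TangentSpace I x) : Prop :=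
  ContMDiff I (I.prod 𝓘(ℝ, E)) ∞ (fun x ↦ TotalSpace.mk' E x (X x))

/-- The 1-form `α` is smooth. -/
def IsSmoothForm (α : Π x : M, TangentSpace I x →L[ℝ] ℝ) : Prop :=
  ContMDiff I (I.prod 𝓘(ℝ, E →L[ℝ] ℝ)) ∞
    (fun x ↦ TotalSpace.mk' (E →L[ℝ] ℝ) (E := fun x : M ↦ TangentSpace I x →L[ℝ] ℝ) x (α x))

/-- The (1,1)-tensor field `A` is smooth. -/
def IsSmoothEnd (A : Π x : M, TangentSpace I x →L[ℝ] TangentSpace I x) : Prop :=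
  ContMDiff I (I.prod 𝓘(ℝ, E →L[ℝ] E)) ∞
    (fun x ↦ TotalSpace.mk' (E →L[ℝ] E)
      (E := fun x : M ↦ TangentSpace I x →L[ℝ] TangentSpace I x) x (A x))

/-! ### Tensorial operations

The values at tangent vectors are computed with the local extensions `FiberBundle.extend` of these
vectors to vector fields that are smooth near the point; the operations are tensorial, so the choice
of the extension plays no role. -/

/-- `(∇_u A) v = ∇_u (A V) - A (∇_u V)` for a (1,1)-tensor field `A`, with `V` extending `v`. -/
def nablaEnd (g : ContMDiffRiemannianMetric I ∞ E (fun x : M ↦ TangentSpace I x))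
    (A : Π x : M, TangentSpace I x →L[ℝ] TangentSpace I x) (x : M) (u v : TangentSpace I x) :
    TangentSpace I x :=
  leviCivita g (fun y ↦ A y (extend E v y)) x u - A x (leviCivita g (extend E v) x u)

/-- The curvature tensor `R_{u,v} w`, where `R_{X,Y} = [∇_X, ∇_Y] - ∇_{[X,Y]}`. -/
def curvature (g : ContMDiffRiemannianMetric I ∞ E (fun x : M ↦ TangentSpace I x))
    (x : M) (u v w : TangentSpace I x) : TangentSpace I x :=
  leviCivita g (fun y ↦ leviCivita g (extend E w) y (extend E v y)) x u
    - leviCivita g (fun y ↦ leviCivita g (extend E w) y (extend E u y)) x v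
    - leviCivita g (extend E w) x (VectorField.mlieBracket I (extend E u) (extend E v) x)

/-- The exterior derivative `dα(X,Y) = X(α(Y)) - Y(α(X)) - α([X,Y])` of a 1-form. -/
def extDerivForm (α : Π x : M, TangentSpace I x →L[ℝ] ℝ) (x : M) (u v : TangentSpace I x) : ℝ :=
  mvfderiv I (fun y ↦ α y (extend E v y)) x u - mvfderiv I (fun y ↦ α y (extend E u y)) x v
    - α x (VectorField.mlieBracket I (extend E u) (extend E v) x)

theorem IsSmoothEnd.mdifferentiableAt {A : Π x : M, TangentSpace I x →L[ℝ] TangentSpace I x}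
    (hA : IsSmoothEnd A) {Y : Π x : M, TangentSpace I x} {x : M} (hY : MDiffAt (T% Y) x) :
    MDiffAt (T% (fun y ↦ A y (Y y))) x :=
  MDifferentiableAt.clm_bundle_apply (F₁ := E) (F₂ := E) ((hA x).mdifferentiableAt (by simp)) hY

theorem IsSmoothForm.mdifferentiableAt {α : Π x : M, TangentSpace I x →L[ℝ] ℝ}
    (hα : IsSmoothForm α) {Y : Π x : M, TangentSpace I x} {x : M} (hY : MDiffAt (T% Y) x) :
    MDiffAt (fun y ↦ α y (Y y)) x := by
  have h : MDifferentiableAt I (I.prod 𝓘(ℝ, ℝ))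
      (fun m ↦ TotalSpace.mk' ℝ (E := Bundle.Trivial M ℝ) m (α m (Y m))) x :=
    MDifferentiableAt.clm_bundle_apply (F₁ := E) ((hα x).mdifferentiableAt (by simp)) hY
  simp only [mdifferentiableAt_totalSpace] at h
  exact h.2

/-- `∇A` may be computed with any extension. -/
theorem nablaEnd_apply (g : ContMDiffRiemannianMetric I ∞ E (fun x : M ↦ TangentSpace I x))
    {A : Π x : M, TangentSpace I x →L[ℝ] TangentSpace I x} (hA : IsSmoothEnd A)
    {Y : Π x : M, TangentSpace I x} {x : M} (hY : MDiffAt (T% Y) x) (u : TangentSpace I x) :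
    nablaEnd g A x u (Y x) =
      leviCivita g (fun y ↦ A y (Y y)) x u - A x (leviCivita g Y x u) := by
  have ht : TensorialAt I E (fun Y : Π x : M, TangentSpace I x ↦
      leviCivita g (fun y ↦ A y (Y y)) x u - A x (leviCivita g Y x u)) x :=
    { smul := by
        intro φ Y hφ hY
        have h1 := (leviCivita g).isCovariantDerivativeOnUniv.leibniz (hA.mdifferentiableAt hY) hφ
        have h2 := (leviCivita g).isCovariantDerivativeOnUniv.leibniz hY hφ
        have h3 : (fun y ↦ A y ((φ • Y) y)) = φ • (fun y ↦ A y (Y y)) := by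
          funext y
          simp
        simp only [h3, h1, h2]
        simp
        module
      add := by
        intro Y Y' hY hY'
        have h1 := (leviCivita g).isCovariantDerivativeOnUniv.add (hA.mdifferentiableAt hY)
          (hA.mdifferentiableAt hY')
        have h2 := (leviCivita g).isCovariantDerivativeOnUniv.add hY hY'
        have h3 : (fun y ↦ A y ((Y + Y') y)) = (fun y ↦ A y (Y y)) + (fun y ↦ A y (Y' y)) := by
          funext y
          simp
        simp only [h3, h1, h2]
        simp
        abel }
  exact ht.pointwise (mdifferentiableAt_extend ..) hY (by simp)

/-- `dα` may be computed with any extensions. -/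
theorem extDerivForm_apply {α : Π x : M, TangentSpace I x →L[ℝ] ℝ} (hα : IsSmoothForm α)
    {X Y : Π x : M, TangentSpace I x} {x : M} (hX : MDiffAt (T% X) x) (hY : MDiffAt (T% Y) x) :
    extDerivForm α x (X x) (Y x) = mvfderiv I (fun y ↦ α y (Y y)) x (X x)
      - mvfderiv I (fun y ↦ α y (X y)) x (Y x) - α x (VectorField.mlieBracket I X Y x) := by
  have h1 : ∀ Z : Π x : M, TangentSpace I x, MDiffAt (T% Z) x →
      TensorialAt I E (fun W : Π x : M, TangentSpace I x ↦ mvfderiv I (fun y ↦ α y (Z y)) x (W x)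
        - mvfderiv I (fun y ↦ α y (W y)) x (Z x) - α x (VectorField.mlieBracket I W Z x)) x := by
    intro Z _
    refine ⟨?_, ?_⟩
    · intro φ W hφ hW
      have a := VectorField.mlieBracket_smul_left (I := I) (W := Z) hφ hW
      have b := mvfderiv_fun_mul hφ (hα.mdifferentiableAt hW)
      simp [a, b]
      ring
    · intro W W' hW hW'
      have a := VectorField.mlieBracket_add_left (I := I) (W := Z) hW hW'
      have b := mvfderiv_fun_add (hα.mdifferentiableAt hW) (hα.mdifferentiableAt hW')
      simp [a, b]
      ring
  have h2 : ∀ W : Π x : M, TangentSpace I x, MDiffAt (T% W) x →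
      TensorialAt I E (fun Z : Π x : M, TangentSpace I x ↦ mvfderiv I (fun y ↦ α y (Z y)) x (W x)
        - mvfderiv I (fun y ↦ α y (W y)) x (Z x) - α x (VectorField.mlieBracket I W Z x)) x := by
    intro W _
    refine ⟨?_, ?_⟩
    · intro φ Z hφ hZ
      have a := VectorField.mlieBracket_smul_right (I := I) (V := W) hφ hZ
      have b := mvfderiv_fun_mul hφ (hα.mdifferentiableAt hZ)
      simp [a, b]
      ring
    · intro Z Z' hZ hZ'
      have a := VectorField.mlieBracket_add_right (I := I) (V := W) hZ hZ'
      have b := mvfderiv_fun_add (hα.mdifferentiableAt hZ) (hα.mdifferentiableAt hZ')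
      simp [a, b]
      ring
  have := TensorialAt.pointwise₂ (I := I) (F := E) (F' := E) (x := x) (A := ℝ)
    (Φ := fun W Z ↦ mvfderiv I (fun y ↦ α y (Z y)) x (W x)
        - mvfderiv I (fun y ↦ α y (W y)) x (Z x) - α x (VectorField.mlieBracket I W Z x)) h1 h2
    (mdifferentiableAt_extend I E (X x)) hX (mdifferentiableAt_extend I E (Y x)) hY
    (by simp) (by simp)
  simpa [extDerivForm] using this

/-! ### Weak metric `f`-structures -/

variable {s : ℕ}

/-- The contact distribution `D = ⋂ᵢ ker ηⁱ`. -/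
def contactDistribution (η : Fin s → Π x : M, TangentSpace I x →L[ℝ] ℝ) (x : M) :
    Submodule ℝ (TangentSpace I x) :=
  ⨅ i, LinearMap.ker (η i x).toLinearMap

/-- `(f, Q, ξ, η, g)` is a weak metric `f`-structure with `f` of rank `2n`. -/
structure IsWeakMetricFStructure (n : ℕ)
    (g : ContMDiffRiemannianMetric I ∞ E (fun x : M ↦ TangentSpace I x))
    (f Q : Π x : M, TangentSpace I x →L[ℝ] TangentSpace I x)
    (ξ : Fin s → Π x : M, TangentSpace I x)
    (η : Fin s → Π x : M, TangentSpace I x →L[ℝ] ℝ) : Prop where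
  smooth_f : IsSmoothEnd f
  smooth_Q : IsSmoothEnd Q
  smooth_ξ : ∀ i, IsSmoothField (ξ i)
  smooth_η : ∀ i, IsSmoothForm (η i)
  f_skew : ∀ x u v, g.inner x (f x u) v = -g.inner x u (f x v)
  f_rank : ∀ x, Module.finrank ℝ (LinearMap.range (f x).toLinearMap) = 2 * n
  Q_selfAdjoint : ∀ x u v, g.inner x (Q x u) v = g.inner x u (Q x v)
  Q_nonsingular : ∀ x, Function.Bijective (Q x)
  ξ_orthonormal : ∀ x i j, g.inner x (ξ i x) (ξ j x) = if i = j then 1 else 0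
  f_sq : ∀ x u, f x (f x u) = -Q x u + ∑ i, η i x u • ξ i x
  η_ξ : ∀ x i j, η i x (ξ j x) = if i = j then 1 else 0
  Q_ξ : ∀ x i, Q x (ξ i x) = ξ i x
  metric_f : ∀ x u v, g.inner x (f x u) (f x v) = g.inner x u (Q x v) - ∑ i, η i x u * η i x v

/-- A weak nearly `C`-structure: a weak metric `f`-structure with `(∇_X f)Y + (∇_Y f)X = 0`. -/
structure IsWeakNearlyCStructure (n : ℕ)
    (g : ContMDiffRiemannianMetric I ∞ E (fun x : M ↦ TangentSpace I x))
    (f Q : Π x : M, TangentSpace I x →L[ℝ] TangentSpace I x)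
    (ξ : Fin s → Π x : M, TangentSpace I x)
    (η : Fin s → Π x : M, TangentSpace I x →L[ℝ] ℝ) : Prop
    extends IsWeakMetricFStructure n g f Q ξ η where
  nabla_f : ∀ x u v, nablaEnd g f x u v + nablaEnd g f x v u = 0

/-- The vector field `X` is Killing: `(£_X g)(u, v) = g(∇_u X, v) + g(∇_v X, u) = 0`. -/
def IsKilling (g : ContMDiffRiemannianMetric I ∞ E (fun x : M ↦ TangentSpace I x))
    (X : Π x : M, TangentSpace I x) : Prop :=
  ∀ x u v, g.inner x (leviCivita g X x u) v + g.inner x (leviCivita g X x v) u = 0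

/-- A weak `f`-K-contact structure: a weak metric `f`-structure whose fundamental form
`Φ(X,Y) = g(X, fY)` is the differential of every `ηⁱ` and whose fields `ξᵢ` are Killing. Here the
differential is taken in the normalization of contact metric geometry,
`½ (X(η(Y)) - Y(η(X)) - η([X,Y]))`, whence the factor `1 / 2` in front of `extDerivForm`. -/
structure IsWeakFKContactStructure (n : ℕ)
    (g : ContMDiffRiemannianMetric I ∞ E (fun x : M ↦ TangentSpace I x))
    (f Q : Π x : M, TangentSpace I x →L[ℝ] TangentSpace I x)
    (ξ : Fin s → Π x : M, TangentSpace I x)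
    (η : Fin s → Π x : M, TangentSpace I x →L[ℝ] ℝ) : Prop
    extends IsWeakMetricFStructure n g f Q ξ η where
  fundamental : ∀ i x u v, g.inner x u (f x v) = (1 / 2 : ℝ) * extDerivForm (η i) x u v
  killing : ∀ i, IsKilling g (ξ i)

/-- The 1-forms `η¹, …, ηˢ` and the splitting `TM = R ⊕ D` form an `s`-contact structure. -/
structure IsSContactStructure (η : Fin s → Π x : M, TangentSpace I x →L[ℝ] ℝ)
    (R : Π x : M, Submodule ℝ (TangentSpace I x)) : Prop where
  smooth_η : ∀ i, IsSmoothForm (η i)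
  linearIndependent : ∀ x, LinearIndependent ℝ (fun i ↦ η i x)
  isCompl : ∀ x, IsCompl (R x) (contactDistribution η x)
  nondegenerate : ∀ i x, ∀ u ∈ contactDistribution η x,
    (∀ v ∈ contactDistribution η x, extDerivForm (η i) x u v = 0) → u = 0
  ker_extDerivForm : ∀ i x u, u ∈ R x ↔ ∀ v, extDerivForm (η i) x u v = 0

/-- The coframe `η¹, …, ηˢ` is uniform: it defines an `s`-contact structure, and
`dηⁱ = dηʲ` for all `i, j`. -/
def IsUniformCoframe (η : Fin s → Π x : M, TangentSpace I x →L[ℝ] ℝ) : Prop :=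
  (∃ R : Π x : M, Submodule ℝ (TangentSpace I x), IsSContactStructure η R) ∧
    ∀ i j x u v, extDerivForm (η i) x u v = extDerivForm (η j) x u v

end Structures

end WeakNearlyC

/-! Put h = ∇ξᵢ, ω(u,v) = g(hu,v) and Ω(u,v) = g(fhu,v). The nearly condition applied to ξᵢ gives
∇_ξ f = fh; differentiating f² = -Q + ∑ ηʲ⊗ξⱼ along ξᵢ then gives hf = -fh (`h_f`). Since ∇_ξ f is
skew, so is h (`h_skew`): the ξᵢ are Killing and dηⁱ = 2ω (`extDeriv_η`). Uniformity now says that h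
is independent of i and invertible on D, and parallelism of Q on D forces Q = id (`Q_eq`), so that
f² = -id on D.

The central step is that (∇_u f)v has no component in D for u, v in D (`metric_nablaEnd_eq_zero`).
For a Killing field, ∇h is a curvature term (`nab_nab_killing`), so the derivative of fh + hf = 0,
the Ricci identity for f and the first Bianchi identity become linear relations between ∇h and ∇f.
Their only solution has the D-part of ∇f equal to zero (`eq_zero_of_skew_relations`). Hence the
3-form g((∇_X f)Y, Z) is (∑ ηʲ) ∧ Ω (`metric_nablaEnd_eq`).

That 3-form is a totally skew covariant derivative of a 2-form, so it is proportional to an exterior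
derivative and therefore closed (`nabDPhi_alternating`). Differentiating (∑ ηʲ) ∧ Ω and restricting
to D, where the ηʲ vanish, leaves ω ∧ Ω = 0 (`wedge_eq_zero`). Contraction with u and hu, where
ω(u,hu) = |hu|² ≠ 0 and Ω(u,hu) = 0, bounds the rank of Ω by 4; as Ω is nondegenerate on D, dim D ≤
4. The vectors u, fu, hu are orthogonal, so dim D ≥ 3, and dim D = 2n leaves n = 2.

The new structure is -h together with -h² + ∑ ηʲ⊗ξⱼ, and R_{u,ξ}ξ = -h²u because ∇_ξ ξ = 0. -/

namespace WeakNearlyC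

open scoped Topology

/-! ### Global smooth vector fields and the operations on them -/

noncomputable section GlobalFields

set_option linter.unusedSectionVars false

variable {E : Type*} [NormedAddCommGroup E] [NormedSpace ℝ E] [FiniteDimensional ℝ E]
  {H : Type*} [TopologicalSpace H] {I : ModelWithCorners ℝ E H}
  {M : Type*} [TopologicalSpace M] [ChartedSpace H M]

/-- A family of continuous linear maps on a finite-dimensional space is smooth as soon as all its
values are. -/
theorem contMDiffAt_clm_of_apply {F : Type*} [NormedAddCommGroup F] [NormedSpace ℝ F]
    {k : WithTop ℕ∞} {A : M → E →L[ℝ] F} {x : M}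
    (h : ∀ v, ContMDiffAt I 𝓘(ℝ, F) k (fun y ↦ A y v) x) :
    ContMDiffAt I 𝓘(ℝ, E →L[ℝ] F) k A x := by
  let b := Module.finBasis ℝ E
  have key : A = fun y ↦ ∑ i, ContinuousLinearMap.smulRightL ℝ E F
      (b.coord i).toContinuousLinearMap (A y (b i)) := by
    funext y
    ext v
    conv_lhs => rw [← b.sum_repr v, map_sum]
    simp
  rw [key]
  refine contMDiffAt_finsetSum fun i _ ↦ ?_
  exact (ContinuousLinearMap.contMDiff _).contMDiffAt.comp x (h (b i))

variable [IsManifold I ∞ M]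

variable (I M) in
/-- Smooth vector fields. -/
abbrev Field := ContMDiffSection I E ∞ (fun x : M ↦ TangentSpace I x)

theorem Field.mdiffAt (X : Field I M) (x : M) : MDiffAt (T% (X : Π x : M, TangentSpace I x)) x :=
  (X.contMDiff x).mdifferentiableAt (by simp)

theorem IsSmoothField.mdiffAt {X : Π x : M, TangentSpace I x} (hX : IsSmoothField X) (x : M) :
    MDiffAt (T% X) x :=
  (hX x).mdifferentiableAt (by simp)

/-- A vector field that is smooth near `x` agrees near `x` with a globally smooth one. -/
theorem exists_field_eventuallyEq [T2Space M] {Y : Π x : M, TangentSpace I x} {x : M} {u : Set M}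
    (hu : u ∈ 𝓝 x) (hY : ContMDiffOn I (I.prod 𝓘(ℝ, E)) ∞ (T% Y) u) :
    ∃ X : Field I M, ∀ᶠ y in 𝓝 x, X y = Y y := by
  obtain ⟨v, hvu, hv, hxv⟩ := mem_nhds_iff.mp hu
  obtain ⟨ψ, -, hψ⟩ :=
    (SmoothBumpFunction.nhds_basis_tsupport (I := I) x).mem_iff.mp (hv.mem_nhds hxv)
  refine ⟨⟨fun y ↦ ((ψ : M → ℝ) • Y) y, ContMDiffOn.smul_section_of_tsupport
    ψ.contMDiff.contMDiffOn hv hψ (hY.mono hvu)⟩, ?_⟩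
  filter_upwards [ψ.eventuallyEq_one] with y hy
  simp [hy]

theorem exists_field_eventuallyEq_extend [T2Space M] {x : M} (v : TangentSpace I x) :
    ∃ X : Field I M, ∀ᶠ y in 𝓝 x, X y = extend E v y := by
  obtain ⟨u, hu, h⟩ := exists_contMDiffOn_extend (k := ∞) I E v
  exact exists_field_eventuallyEq hu h

theorem exists_field_apply_eq [T2Space M] {x : M} (v : TangentSpace I x) :
    ∃ X : Field I M, X x = v := by
  obtain ⟨X, hX⟩ := exists_field_eventuallyEq_extend v
  exact ⟨X, by simpa using hX.self_of_nhds⟩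

/-- Constant coordinate vectors of a trivialization are germs of global fields; this is what reduces
smoothness of a tensor to its values on global fields. -/
theorem exists_field_eventuallyEq_symm [T2Space M] (x : M) (v : E) :
    ∃ X : Field I M, ∀ᶠ y in 𝓝 x,
      X y = (trivializationAt E (fun x : M ↦ TangentSpace I x) x).symm y v := by
  let t := trivializationAt E (fun x : M ↦ TangentSpace I x) x
  obtain ⟨X, hX⟩ := exists_field_eventuallyEq_extend (t.symm x v)
  refine ⟨X, hX.mono fun y hy ↦ ?_⟩
  rw [hy, extend]
  congr 1
  have := t.apply_mk_symm (mem_baseSet_trivializationAt E (fun x : M ↦ TangentSpace I x) x) v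
  simp only [t] at this ⊢
  rw [this]

/-- A family of linear maps from the tangent spaces to the fibres of a vector bundle is smooth if it
maps smooth vector fields to smooth sections. -/
theorem contMDiff_hom_of_apply_field [T2Space M] {F : Type*} [NormedAddCommGroup F]
    [NormedSpace ℝ F]
    {V : M → Type*} [TopologicalSpace (TotalSpace F V)] [∀ x, AddCommGroup (V x)]
    [∀ x, Module ℝ (V x)] [∀ x, TopologicalSpace (V x)] [FiberBundle F V] [VectorBundle ℝ F V]
    [∀ x, IsTopologicalAddGroup (V x)] [∀ x, ContinuousSMul ℝ (V x)]
    {A : Π x : M, TangentSpace I x →L[ℝ] V x}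
    (h : ∀ X : Field I M, ContMDiff I (I.prod 𝓘(ℝ, F)) ∞ (fun x ↦ TotalSpace.mk' F x (A x (X x)))) :
    ContMDiff I (I.prod 𝓘(ℝ, E →L[ℝ] F)) ∞ (fun x ↦ TotalSpace.mk' (E →L[ℝ] F)
      (E := fun x : M ↦ TangentSpace I x →L[ℝ] V x) x (A x)) := by
  intro x
  rw [contMDiffAt_hom_bundle]
  refine ⟨contMDiffAt_id, contMDiffAt_clm_of_apply fun v ↦ ?_⟩
  obtain ⟨X, hX⟩ := exists_field_eventuallyEq_symm (I := I) x v
  have hs := (contMDiffAt_section x).mp (h X x)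
  refine hs.congr_of_eventuallyEq ?_
  have hb := (trivializationAt E (fun x : M ↦ TangentSpace I x) x).open_baseSet.mem_nhds
    (mem_baseSet_trivializationAt E (fun x : M ↦ TangentSpace I x) x)
  have hb' := (trivializationAt F V x).open_baseSet.mem_nhds
    (mem_baseSet_trivializationAt F V x)
  filter_upwards [hX, hb, hb'] with y hy h1 h2
  rw [ContinuousLinearMap.inCoordinates_eq h1 h2, hy]
  simp

theorem isSmoothEnd_of_apply_field [T2Space M]
    {A : Π x : M, TangentSpace I x →L[ℝ] TangentSpace I x}
    (h : ∀ X : Field I M, IsSmoothField fun x ↦ A x (X x)) : IsSmoothEnd A :=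
  contMDiff_hom_of_apply_field h

variable [T2Space M] (g : ContMDiffRiemannianMetric I ∞ E (fun x : M ↦ TangentSpace I x))

theorem contMDiff_metric {X Y : Π x : M, TangentSpace I x} (hX : IsSmoothField X)
    (hY : IsSmoothField Y) : ContMDiff I 𝓘(ℝ, ℝ) ∞ (fun x ↦ g.inner x (X x) (Y x)) := by
  intro x
  have h : ContMDiffAt I (I.prod 𝓘(ℝ, ℝ)) ∞
      (fun m ↦ TotalSpace.mk' ℝ (E := Bundle.Trivial M ℝ) m (g.inner m (X m) (Y m))) x :=
    ContMDiffAt.clm_bundle_apply₂ (F₁ := E) (F₂ := E) (g.contMDiff x) (hX x) (hY x)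
  simp only [contMDiffAt_totalSpace] at h
  exact h.2

/-- The musical isomorphism `T*M → TM` preserves smoothness. -/
theorem isSmoothField_of_metric {Z : Π x : M, TangentSpace I x}
    (h : ∀ W : Field I M, ContMDiff I 𝓘(ℝ, ℝ) ∞ (fun x ↦ g.inner x (Z x) (W x))) :
    IsSmoothField Z := by
  intro x
  rw [contMDiffAt_section]
  let t := trivializationAt E (fun x : M ↦ TangentSpace I x) x
  have hx := mem_baseSet_trivializationAt E (fun x : M ↦ TangentSpace I x) x
  have hb := t.open_baseSet.mem_nhds hx
  let σ : M → E →L[ℝ] E := fun y ↦ t.symmL ℝ y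
  have hσ : ∀ y ∈ t.baseSet, ∀ v, σ y v = t.symm y v := fun y hy v ↦ t.symmL_apply hy v
  -- In the trivialization β is the covector dual to Z and γ the Gram form of the metric; the
  -- coordinates of Z are γ⁻¹β, and inversion is smooth.
  let β : M → E →L[ℝ] ℝ := fun y ↦ (g.inner y (Z y)).comp (σ y)
  let γ : M → E →L[ℝ] E →L[ℝ] ℝ := fun y ↦
    ((ContinuousLinearMap.compL ℝ E E ℝ).flip (σ y)).comp ((g.inner y).comp (σ y))
  have hγ : ∀ y u v, γ y u v = g.inner y (σ y u) (σ y v) := fun y u v ↦ rfl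
  have hβs : ContMDiffAt I 𝓘(ℝ, E →L[ℝ] ℝ) ∞ β x := by
    refine contMDiffAt_clm_of_apply fun v ↦ ?_
    obtain ⟨X, hX⟩ := exists_field_eventuallyEq_symm (I := I) x v
    refine (h X x).congr_of_eventuallyEq ?_
    filter_upwards [hX, hb] with y hy hyb
    rw [hy]
    exact congrArg _ (hσ y hyb v)
  have hγs : ContMDiffAt I 𝓘(ℝ, E →L[ℝ] E →L[ℝ] ℝ) ∞ γ x := by
    refine contMDiffAt_clm_of_apply fun u ↦ contMDiffAt_clm_of_apply fun v ↦ ?_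
    obtain ⟨X, hX⟩ := exists_field_eventuallyEq_symm (I := I) x u
    obtain ⟨Y, hY⟩ := exists_field_eventuallyEq_symm (I := I) x v
    refine (contMDiff_metric g X.contMDiff Y.contMDiff x).congr_of_eventuallyEq ?_
    filter_upwards [hX, hY, hb] with y hy hy' hyb
    rw [hγ, hy, hy', hσ y hyb, hσ y hyb]
  have hinv : ∀ y ∈ t.baseSet, (γ y).IsInvertible := by
    intro y hy
    refine isInvertible_of_pos _ fun v hv ↦ ?_
    refine g.pos y _ fun h0 ↦ hv ?_
    have h1 := t.continuousLinearMapAt_symmL (R := ℝ) hy v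
    rw [show t.symmL ℝ y v = 0 from h0, map_zero] at h1
    exact h1.symm
  have hinvs : ContMDiffAt I 𝓘(ℝ, (E →L[ℝ] ℝ) →L[ℝ] E) ∞ (fun y ↦ (γ y).inverse) x := by
    obtain ⟨e, he⟩ := hinv x hx
    have := contDiffAt_map_inverse (n := ∞) e
    rw [he] at this
    exact ContMDiffAt.comp x this.contMDiffAt hγs
  refine (hinvs.clm_apply hβs).congr_of_eventuallyEq ?_
  filter_upwards [hb] with y hy
  obtain ⟨e, he⟩ := hinv y hy
  have key : β y = γ y (t ⟨y, Z y⟩).2 := by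
    ext v
    rw [hγ]
    change g.inner y (Z y) (σ y v) = _
    congr 2
    rw [hσ y hy]
    exact (t.symm_apply_apply_mk hy (Z y)).symm
  rw [key, ← he]
  simp
  rfl

/-! ### Operations on smooth fields -/

omit [T2Space M] in
theorem contMDiff_mvfderiv {φ : M → ℝ} (hφ : ContMDiff I 𝓘(ℝ, ℝ) ∞ φ) (X : Field I M) :
    ContMDiff I 𝓘(ℝ, ℝ) ∞ (fun x ↦ mvfderiv I φ x (X x)) := by
  have h := (hφ.contMDiff_tangentMap (m := ∞) (by simp)).comp X.contMDiff
  exact (contMDiff_snd_tangentBundle_modelSpace ℝ 𝓘(ℝ, ℝ)).comp h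

omit [T2Space M] in
theorem isSmoothField_mlieBracket (X Y : Field I M) :
    IsSmoothField (VectorField.mlieBracket I X Y) := by
  have : IsManifold I (((⊤ : ℕ∞) : WithTop ℕ∞) + 1) M := by simpa
  have : IsManifold I (minSmoothness ℝ 2) M := IsManifold.of_le (n := ∞) (by
    simpa using WithTop.coe_le_coe.2 (le_top : (2 : ℕ∞) ≤ ⊤))
  exact ContDiff.mlieBracket_vectorField (m := ⊤) (n := ⊤) X.contMDiff Y.contMDiff (by simp)

theorem isSmoothField_leviCivita (X Y : Field I M) :
    IsSmoothField (fun x ↦ leviCivita g Y x (X x)) := by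
  refine isSmoothField_of_metric g fun W ↦ ?_
  have h : (fun x ↦ g.inner x (leviCivita g Y x (X x)) (W x))
      = fun x ↦ (1 / 2 : ℝ) * koszul g Y X W x := by
    funext x
    have := metric_nablaFun g (Y.mdiffAt x) (X.mdiffAt x) (W.mdiffAt x)
    change g.inner x (nablaFun g Y x (X x)) (W x) = _
    linarith
  rw [h]
  refine contMDiff_const.mul ?_
  unfold koszul
  have a := fun X Y Z : Field I M ↦
    contMDiff_mvfderiv (contMDiff_metric g X.contMDiff Y.contMDiff) Z
  have b := fun X Y Z : Field I M ↦
    contMDiff_metric g (isSmoothField_mlieBracket X Y) Z.contMDiff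
  exact (((((a Y W X).add (a X W Y)).sub (a X Y W)).add (b X Y W)).sub (b X W Y)).sub (b Y W X)

variable (I M) in
/-- Smooth functions. -/
abbrev Fn := ContMDiffMap I 𝓘(ℝ, ℝ) M ℝ ∞

omit [T2Space M] in
theorem Fn.mdiffAt (φ : Fn I M) (x : M) : MDiffAt φ x :=
  (φ.contMDiff x).mdifferentiableAt (by simp)

/-- The function `g(X, Y)`. -/
def met : Field I M →+ Field I M →+ Fn I M :=
  AddMonoidHom.mk'
    (fun X ↦ AddMonoidHom.mk' (fun Y ↦ ⟨fun x ↦ g.inner x (X x) (Y x),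
      contMDiff_metric g X.contMDiff Y.contMDiff⟩) (by
        intro Y Y'; ext x; exact map_add (g.inner x (X x)) _ _))
    (by intro X X'; ext Y x; exact congrArg (fun L ↦ L (Y x)) (map_add (g.inner x) (X x) (X' x)))

/-- The derivative of a function along a vector field. -/
def der : Field I M →+ Fn I M →+ Fn I M :=
  AddMonoidHom.mk'
    (fun X ↦ AddMonoidHom.mk' (fun φ ↦ ⟨fun x ↦ mvfderiv I φ x (X x),
      contMDiff_mvfderiv φ.contMDiff X⟩) (by
        intro φ ψ; ext x
        exact congrArg (fun L ↦ L (X x)) (mvfderiv_add (φ.mdiffAt x) (ψ.mdiffAt x))))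
    (by intro X X'; ext φ x; exact map_add (mvfderiv I φ x) _ _)

/-- The Lie bracket. -/
def brk (X Y : Field I M) : Field I M :=
  ⟨VectorField.mlieBracket I X Y, isSmoothField_mlieBracket X Y⟩

/-- The covariant derivative `∇_X Y`. -/
def nab : Field I M →+ Field I M →+ Field I M :=
  AddMonoidHom.mk'
    (fun X ↦ AddMonoidHom.mk' (fun Y ↦ ⟨fun x ↦ leviCivita g Y x (X x),
      isSmoothField_leviCivita g X Y⟩) (by
        intro Y Y'; ext x
        have := (leviCivita g).isCovariantDerivativeOnUniv.add (Y.mdiffAt x) (Y'.mdiffAt x)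
        change leviCivita g ((Y : Π x : M, TangentSpace I x) + Y') x (X x) = _
        rw [this]
        rfl))
    (by intro X X'; ext Y x; exact map_add (leviCivita g Y x) _ _)

/-- The action of a smooth (1,1)-tensor field on vector fields. -/
def IsSmoothEnd.app {A : Π x : M, TangentSpace I x →L[ℝ] TangentSpace I x} (hA : IsSmoothEnd A) :
    Field I M →+ Field I M :=
  AddMonoidHom.mk' (fun X ↦ ⟨fun x ↦ A x (X x), fun x ↦
    ContMDiffAt.clm_bundle_apply (F₁ := E) (F₂ := E) (hA x) (X.contMDiff x)⟩)
    (by intro X X'; ext x; exact map_add (A x) _ _)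

@[simp] theorem met_apply (X Y : Field I M) (x : M) : met g X Y x = g.inner x (X x) (Y x) := rfl

@[simp] theorem der_apply (X : Field I M) (φ : Fn I M) (x : M) :
    der X φ x = mvfderiv I φ x (X x) := rfl

@[simp] theorem nab_apply (X Y : Field I M) (x : M) : nab g X Y x = leviCivita g Y x (X x) := rfl

@[simp] theorem IsSmoothEnd.app_apply {A : Π x : M, TangentSpace I x →L[ℝ] TangentSpace I x}
    (hA : IsSmoothEnd A) (X : Field I M) (x : M) : hA.app X x = A x (X x) := rfl

theorem met_symm (X Y : Field I M) : met g X Y = met g Y X := by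
  ext x
  exact g.symm x _ _

theorem eq_of_met {X Y : Field I M} (h : ∀ Z, met g X Z = met g Y Z) : X = Y := by
  ext x
  refine metric_nondegenerate g fun w ↦ ?_
  obtain ⟨W, rfl⟩ := exists_field_apply_eq w
  exact congrArg (fun φ : Fn I M ↦ φ x) (h W)

theorem der_met (X Y Z : Field I M) :
    der X (met g Y Z) = met g (nab g X Y) Z + met g Y (nab g X Z) := by
  ext x
  exact leviCivita_metric g (X.mdiffAt x) (Y.mdiffAt x) (Z.mdiffAt x)

theorem brk_eq (X Y : Field I M) : brk X Y = nab g X Y - nab g Y X := by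
  ext x
  exact (leviCivita_torsion g (X.mdiffAt x) (Y.mdiffAt x)).symm

theorem der_mul (X : Field I M) (φ ψ : Fn I M) :
    der X (φ * ψ) = der X φ * ψ + φ * der X ψ := by
  ext x
  have := congrArg (fun L ↦ L (X x)) (mvfderiv_mul (φ.mdiffAt x) (ψ.mdiffAt x))
  change mvfderiv I (φ * ψ : M → ℝ) x (X x)
    = mvfderiv I φ x (X x) * ψ x + φ x * mvfderiv I ψ x (X x)
  rw [this]
  simp
  ring

theorem brk_jacobi (X Y Z : Field I M) :
    brk X (brk Y Z) = brk (brk X Y) Z + brk Y (brk X Z) := by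
  have h3 : minSmoothness ℝ 3 ≤ ∞ := by simpa using WithTop.coe_le_coe.2 (le_top : (3 : ℕ∞) ≤ ⊤)
  have h2 : minSmoothness ℝ 2 ≤ ∞ := by simpa using WithTop.coe_le_coe.2 (le_top : (2 : ℕ∞) ≤ ⊤)
  have : IsManifold I (minSmoothness ℝ 3) M := IsManifold.of_le (n := ∞) h3
  ext x
  exact VectorField.leibniz_identity_mlieBracket_apply ((X.contMDiff x).of_le h2)
    ((Y.contMDiff x).of_le h2) ((Z.contMDiff x).of_le h2)

/-- The product of a function and a vector field. -/
def fsmul (φ : Fn I M) (X : Field I M) : Field I M :=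
  ⟨fun x ↦ φ x • X x, φ.contMDiff.smul_section X.contMDiff⟩

theorem brk_fsmul (X Y : Field I M) (φ : Fn I M) :
    brk X (fsmul φ Y) = fsmul (der X φ) Y + fsmul φ (brk X Y) := by
  ext x
  exact VectorField.mlieBracket_smul_right (I := I) (φ.mdiffAt x) (Y.mdiffAt x)

theorem brk_add_right (X Y Z : Field I M) : brk X (Y + Z) = brk X Y + brk X Z := by
  ext x
  exact VectorField.mlieBracket_add_right (I := I) (Y.mdiffAt x) (Z.mdiffAt x)

theorem fsmul_apply (φ : Fn I M) (X : Field I M) (x : M) : fsmul φ X x = φ x • X x := rfl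

/-- Follows from the Jacobi identity for X, Y and φZ: after the brackets of Z cancel, the claim
remains as a coefficient of Z. The field Z can be chosen nonzero at the point unless E is trivial,
and then every derivative is zero. -/
theorem der_brk (X Y : Field I M) (φ : Fn I M) :
    der (brk X Y) φ = der X (der Y φ) - der Y (der X φ) := by
  ext x
  rcases subsingleton_or_nontrivial E with hE | hE
  · have h0 : ∀ (Z : Field I M) (ψ : Fn I M), der Z ψ x = 0 := fun Z ψ ↦ by
      have : Z x = 0 := hE.elim _ _
      simp [this]
    change der (brk X Y) φ x = der X (der Y φ) x - der Y (der X φ) x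
    rw [h0, h0, h0, sub_zero]
  · obtain ⟨v, hv⟩ := exists_ne (0 : E)
    obtain ⟨Z, hZ⟩ := exists_field_apply_eq (I := I) (x := x) v
    have hj := brk_jacobi X Y (fsmul φ Z)
    simp only [brk_fsmul, brk_add_right] at hj
    have hk := congrArg (fun V : Field I M ↦ V x) (brk_jacobi X Y Z)
    have hj' := congrArg (fun V : Field I M ↦ V x) hj
    simp only [ContMDiffSection.coe_add, Pi.add_apply, fsmul_apply] at hj' hk
    rw [hk] at hj'
    have h : (der (brk X Y) φ x - (der X (der Y φ) x - der Y (der X φ) x)) • Z x = 0 := by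
      rw [sub_smul, sub_smul]
      rw [smul_add] at hj'
      rw [← neg_eq_zero, ← sub_eq_zero.mpr hj']
      abel
    have h' := (smul_eq_zero.mp h).resolve_right (by rw [hZ]; exact hv)
    exact sub_eq_zero.mp h'

end GlobalFields

/-! ### Curvature symmetries, Killing fields and tensoriality of the curvature -/

noncomputable section CurvatureTensor

set_option linter.unusedSectionVars false

variable {E : Type*} [NormedAddCommGroup E] [NormedSpace ℝ E] [FiniteDimensional ℝ E]
  {H : Type*} [TopologicalSpace H] {I : ModelWithCorners ℝ E H}
  {M : Type*} [TopologicalSpace M] [ChartedSpace H M] [IsManifold I ∞ M] [T2Space M]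
  (g : ContMDiffRiemannianMetric I ∞ E (fun x : M ↦ TangentSpace I x))

/-- The curvature operator `R_{X,Y} = [∇_X, ∇_Y] - ∇_{[X,Y]}` on smooth fields. -/
def curv (X Y : Field I M) : Field I M →+ Field I M :=
  (nab g X).comp (nab g Y) - (nab g Y).comp (nab g X) - nab g (brk X Y)

theorem curv_apply (X Y Z : Field I M) :
    curv g X Y Z = nab g X (nab g Y Z) - nab g Y (nab g X Z) - nab g (brk X Y) Z := rfl

theorem brk_symm (X Y : Field I M) : brk X Y = -brk Y X := by
  ext x
  exact VectorField.mlieBracket_swap_apply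

theorem curv_skew (X Y Z : Field I M) : curv g X Y Z = -curv g Y X Z := by
  rw [curv_apply, curv_apply, brk_symm X Y, map_neg, AddMonoidHom.neg_apply]
  abel

/-- The commutator [∇_X, ∇_Y] - ∇_{[X,Y]} is zero on the function g(Z,W), and the metric is
parallel. -/
theorem met_curv_skew (X Y Z W : Field I M) :
    met g (curv g X Y Z) W = -met g (curv g X Y W) Z := by
  have h := der_brk X Y (met g Z W)
  simp only [der_met, map_add] at h
  simp only [curv_apply, map_sub, AddMonoidHom.sub_apply]
  rw [met_symm g (nab g X (nab g Y W)) Z, met_symm g (nab g Y (nab g X W)) Z,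
    met_symm g (nab g (brk X Y) W) Z]
  linear_combination -h

/-- Vanishing torsion turns the cyclic sum into the Jacobi identity. -/
theorem curv_bianchi (X Y Z : Field I M) :
    curv g X Y Z + curv g Y Z X + curv g Z X Y = 0 := by
  have h := brk_jacobi X Y Z
  have e : ∀ U V W : Field I M, nab g (brk U V) W = nab g W (brk U V) + brk (brk U V) W :=
    fun U V W ↦ by rw [brk_eq g (brk U V) W]; abel
  rw [brk_symm X (brk Y Z), brk_symm Y (brk X Z), brk_symm X Z] at h
  simp only [curv_apply, e]
  have hn : ∀ U V : Field I M, brk (-U) V = -brk U V := fun U V ↦ by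
    rw [brk_eq g, brk_eq g, map_neg, map_neg, AddMonoidHom.neg_apply]; abel
  rw [hn] at h
  have h2 : brk (brk X Y) Z = -brk (brk Y Z) X - brk (brk Z X) Y := by
    rw [h]; abel
  rw [h2]
  simp only [brk_eq g X Y, brk_eq g Y Z, brk_eq g Z X, map_sub]
  abel

theorem met_curv_bianchi (X Y Z W : Field I M) :
    met g (curv g X Y Z) W + met g (curv g Y Z X) W + met g (curv g Z X Y) W = 0 := by
  rw [← AddMonoidHom.add_apply, ← map_add, ← AddMonoidHom.add_apply, ← map_add, curv_bianchi]
  simp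

theorem met_curv_skew_left (X Y Z W : Field I M) :
    met g (curv g X Y Z) W = -met g (curv g Y X Z) W := by
  rw [curv_skew]; simp

theorem two_mul_cancel {a b : Fn I M} (h : 2 * a = 2 * b) : a = b := by
  ext x
  have := congrArg (fun φ : Fn I M ↦ φ x) h
  rw [two_mul, two_mul] at this
  change a x + a x = b x + b x at this
  linarith

/-- The classical octahedron argument: a signed sum of the four Bianchi identities, simplified by
the two skew symmetries. -/
theorem met_curv_pair (X Y Z W : Field I M) :
    met g (curv g X Y Z) W = met g (curv g Z W X) Y := by
  apply two_mul_cancel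
  have b1 := met_curv_bianchi g X Y Z W
  have b2 := met_curv_bianchi g Y Z W X
  have b3 := met_curv_bianchi g Z W X Y
  have b4 := met_curv_bianchi g W X Y Z
  have s := met_curv_skew g
  have t := met_curv_skew_left g
  have e1 : met g (curv g X Z W) Y = met g (curv g Z X Y) W := by rw [s, t, neg_neg]
  have e2 : met g (curv g Y W X) Z = met g (curv g W Y Z) X := by rw [s, t, neg_neg]
  linear_combination b1 + b2 - b3 - b4 - s Y Z W X - s Z W Y X + e1 + s W X Y Z + s X Y W Z + e2

/-- `∇²ξ` is a curvature term for a Killing field `ξ`. -/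
theorem nab_nab_killing {ξ : Field I M}
    (hξ : ∀ X Y, met g (nab g X ξ) Y + met g (nab g Y ξ) X = 0) (X Y : Field I M) :
    nab g X (nab g Y ξ) - nab g (nab g X Y) ξ = curv g X ξ Y := by
  have s := met_curv_skew g
  have t := met_curv_skew_left g
  -- α is g(∇²ξ, ·). It is skew in its last two slots by the Killing equation, and its skew part in
  -- the first two is curvature; as in the Koszul formula, this determines α.
  let α : Field I M → Field I M → Field I M → Fn I M := fun X Y Z ↦
    met g (nab g X (nab g Y ξ)) Z - met g (nab g (nab g X Y) ξ) Z
  have h1 : ∀ X Y Z, α X Y Z + α X Z Y = 0 := by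
    intro X Y Z
    have h := congrArg (der X) (hξ Y Z)
    simp only [map_add, der_met, map_zero] at h
    have k1 := hξ (nab g X Y) Z
    have k2 := hξ (nab g X Z) Y
    rw [met_symm g (nab g Z ξ)] at k1
    rw [met_symm g (nab g Y ξ)] at k2
    simp only [α]
    rw [met_symm g (nab g Z ξ)] at h
    rw [met_symm g (nab g Y ξ)] at h
    linear_combination h - k1 - k2
  have h2 : ∀ X Y Z, α X Y Z - α Y X Z = met g (curv g X Y ξ) Z := by
    intro X Y Z
    simp only [α, curv_apply, brk_eq g X Y, map_sub, AddMonoidHom.sub_apply]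
    ring
  apply eq_of_met g
  intro Z
  apply two_mul_cancel
  rw [map_sub, AddMonoidHom.sub_apply]
  change 2 * α X Y Z = _
  have b := met_curv_bianchi g X Y Z ξ
  have a1 := h2 X Y Z
  have a2 := h2 Y Z X
  have a3 := h2 Z X Y
  rw [s] at a1 a2 a3
  have p := met_curv_pair g X ξ Y Z
  rw [p]
  linear_combination a1 - a2 + a3 + h1 Y X Z - h1 Z X Y + h1 X Y Z - b

/-! ### Comparison with the pointwise curvature tensor -/

theorem isSmoothEnd_leviCivita (Y : Field I M) : IsSmoothEnd (leviCivita g Y) :=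
  isSmoothEnd_of_apply_field fun X ↦ isSmoothField_leviCivita g X Y

theorem nablaEnd_apply_field {A : Π x : M, TangentSpace I x →L[ℝ] TangentSpace I x}
    (hA : IsSmoothEnd A) (X Y : Field I M) (x : M) :
    nablaEnd g A x (X x) (Y x) = (nab g X (hA.app Y) - hA.app (nab g X Y)) x :=
  nablaEnd_apply g hA (Y.mdiffAt x) (X x)

/-- ∇A is tensorial in Y, so Y may be compared with the zero field. -/
theorem nab_app_eq_of_eq_zero {A : Π x : M, TangentSpace I x →L[ℝ] TangentSpace I x}
    (hA : IsSmoothEnd A) (X : Field I M) {Y : Field I M} {x : M} (hY : Y x = 0) :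
    nab g X (hA.app Y) x = hA.app (nab g X Y) x := by
  have h1 := nablaEnd_apply_field g hA X Y x
  have h2 := nablaEnd_apply_field g hA X 0 x
  rw [hY] at h1
  change nablaEnd g A x (X x) 0 = _ at h2
  rw [h2] at h1
  simp only [map_zero, sub_zero] at h1
  exact sub_eq_zero.mp h1.symm

/-- Regard ∇Z as a (1,1)-tensor: R_{X,Y}Z = (∇_X ∇Z)Y - (∇_Y ∇Z)X, which is tensorial in X. -/
theorem curv_eq_zero_of_left {X : Field I M} {x : M} (hX : X x = 0) (Y Z : Field I M) :
    curv g X Y Z x = 0 := by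
  have hs := isSmoothEnd_leviCivita g Z
  have h1 := nab_app_eq_of_eq_zero g hs Y hX
  have h2 : hs.app X = nab g X Z := rfl
  have h3 : ∀ U : Field I M, nab g U Z = hs.app U := fun U ↦ rfl
  have h4 : nab g X (nab g Y Z) x = 0 := by rw [nab_apply, hX, map_zero]
  have h5 : hs.app (nab g X Y) x = 0 := by
    rw [IsSmoothEnd.app_apply, nab_apply, hX, map_zero, map_zero]
  rw [curv_apply, brk_eq g, h3 (_ - _), map_sub, h3 X]
  change nab g X (nab g Y Z) x - nab g Y (hs.app X) x
    - (hs.app (nab g X Y) x - hs.app (nab g Y X) x) = 0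
  rw [h4, h1, h5]
  abel

/-- Dependence on the first slot is pointwise; skew symmetry carries this to the second slot and
pair symmetry to the third. -/
theorem curv_congr {X X' Y Y' Z Z' : Field I M} {x : M} (hX : X x = X' x) (hY : Y x = Y' x)
    (hZ : Z x = Z' x) : curv g X Y Z x = curv g X' Y' Z' x := by
  have left : ∀ {X X' : Field I M} (Y Z : Field I M), X x = X' x →
      curv g X Y Z x = curv g X' Y Z x := by
    intro X X' Y Z h
    have h0 := curv_eq_zero_of_left g (X := X - X') (x := x)
      (by rw [ContMDiffSection.coe_sub, Pi.sub_apply, h, sub_self]) Y Z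
    have h1 : curv g (X - X') Y Z = curv g X Y Z - curv g X' Y Z := by
      simp only [curv_apply, brk_eq g, map_sub, AddMonoidHom.sub_apply]
      abel
    rw [h1] at h0
    exact sub_eq_zero.mp h0
  have right : ∀ (X Y : Field I M) {Z Z' : Field I M}, Z x = Z' x →
      curv g X Y Z x = curv g X Y Z' x := by
    intro X Y Z Z' h
    refine metric_nondegenerate g fun w ↦ ?_
    obtain ⟨W, rfl⟩ := exists_field_apply_eq w
    change met g (curv g X Y Z) W x = met g (curv g X Y Z') W x
    rw [met_curv_pair, met_curv_pair g X Y Z', met_apply, met_apply, left _ _ h]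
  rw [left _ _ hX, curv_skew]
  rw [curv_skew g X' Y' Z']
  change -(curv g Y X' Z x) = -(curv g Y' X' Z' x)
  rw [left _ _ hY, right _ _ hZ]

theorem leviCivita_congr {Y Y' : Π x : M, TangentSpace I x} {x : M} (hY : MDiffAt (T% Y) x)
    (h : ∀ᶠ y in 𝓝 x, Y y = Y' y) : leviCivita g Y x = leviCivita g Y' x := by
  refine (leviCivita g).isCovariantDerivativeOnUniv.congr_of_eventuallyEq hY ?_ Filter.univ_mem h
  exact hY.congr_of_eventuallyEq (h.mono fun y hy ↦ by simp only [hy])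

/-- The bridge between the operator calculus on global fields and the curvature defined by local
extensions: global fields with the same germs at x give the same value. -/
theorem curvature_apply_field (X Y Z : Field I M) (x : M) :
    curvature g x (X x) (Y x) (Z x) = curv g X Y Z x := by
  obtain ⟨X', hX⟩ := exists_field_eventuallyEq_extend (X x)
  obtain ⟨Y', hY⟩ := exists_field_eventuallyEq_extend (Y x)
  obtain ⟨Z', hZ⟩ := exists_field_eventuallyEq_extend (Z x)
  have eX : X' x = X x := by simpa using hX.self_of_nhds
  have eY : Y' x = Y x := by simpa using hY.self_of_nhds
  have eZ : Z' x = Z x := by simpa using hZ.self_of_nhds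
  rw [← curv_congr g eX eY eZ]
  have hnab : ∀ U : Field I M, ∀ u : TangentSpace I x, (∀ᶠ y in 𝓝 x, U y = extend E u y) →
      leviCivita g (fun y ↦ leviCivita g (extend E (Z x)) y (extend E u y)) x =
        leviCivita g (nab g U Z') x := by
    intro U u hU
    symm
    refine leviCivita_congr g ((nab g U Z').mdiffAt x) ?_
    filter_upwards [hU, hZ.eventually_nhds] with y hy hy'
    rw [nab_apply, leviCivita_congr g (Z'.mdiffAt y) hy', hy]
  have hb : brk X' Y' x = VectorField.mlieBracket I (extend E (X x)) (extend E (Y x)) x :=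
    Filter.EventuallyEq.mlieBracket_vectorField_eq hX hY
  rw [curvature, hnab X' _ hX, hnab Y' _ hY, ← hb,
    ← leviCivita_congr g (Z'.mdiffAt x) hZ, ← eX, ← eY]
  rfl

end CurvatureTensor

/-! ### The endomorphism h = ∇ξ and its consequences for f and Q -/

noncomputable section NearlyC

set_option linter.unusedSectionVars false

variable {E : Type*} [NormedAddCommGroup E] [NormedSpace ℝ E] [FiniteDimensional ℝ E]
  {H : Type*} [TopologicalSpace H] {I : ModelWithCorners ℝ E H}
  {M : Type*} [TopologicalSpace M] [ChartedSpace H M] [IsManifold I ∞ M] [T2Space M]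
  {g : ContMDiffRiemannianMetric I ∞ E (fun x : M ↦ TangentSpace I x)}

instance (x : M) : FiniteDimensional ℝ (TangentSpace I x) :=
  inferInstanceAs (FiniteDimensional ℝ E)

theorem Field.sum_apply {ι : Type*} (t : Finset ι) (X : ι → Field I M) (x : M) :
    (∑ i ∈ t, X i) x = ∑ i ∈ t, X i x := by
  rw [← ContMDiffSection.coeAddHom_apply, map_sum, Finset.sum_apply]
  rfl

theorem eq_zero_of_metric_self {x : M} {u : TangentSpace I x} (h : g.inner x u u = 0) : u = 0 := by
  by_contra hu
  exact (g.pos x u hu).ne' h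

theorem mem_contactDistribution {s : ℕ} {η : Fin s → Π x : M, TangentSpace I x →L[ℝ] ℝ} {x : M}
    {u : TangentSpace I x} : u ∈ contactDistribution η x ↔ ∀ i, η i x u = 0 := by
  simp [contactDistribution]

variable {n s : ℕ} {f Q : Π x : M, TangentSpace I x →L[ℝ] TangentSpace I x}
  {ξ : Fin s → Π x : M, TangentSpace I x} {η : Fin s → Π x : M, TangentSpace I x →L[ℝ] ℝ}

namespace IsWeakMetricFStructure

variable (S : IsWeakMetricFStructure n g f Q ξ η)

include S

theorem f_ξ (x : M) (i : Fin s) : f x (ξ i x) = 0 := by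
  apply eq_zero_of_metric_self (g := g)
  rw [S.metric_f, S.Q_ξ, S.ξ_orthonormal]
  simp [S.η_ξ]

theorem η_eq (x : M) (i : Fin s) (u : TangentSpace I x) : η i x u = g.inner x (ξ i x) u := by
  have h := S.metric_f x (ξ i x) u
  rw [S.f_ξ, ← S.Q_selfAdjoint, S.Q_ξ] at h
  simp [S.η_ξ] at h
  linarith

theorem mem_iff (x : M) (u : TangentSpace I x) :
    u ∈ contactDistribution η x ↔ ∀ i, g.inner x (ξ i x) u = 0 := by
  simp_rw [mem_contactDistribution, S.η_eq]

theorem η_f (x : M) (i : Fin s) (u : TangentSpace I x) : η i x (f x u) = 0 := by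
  rw [S.η_eq, g.symm, S.f_skew, S.f_ξ, map_zero, neg_zero]

theorem f_mem (x : M) (u : TangentSpace I x) : f x u ∈ contactDistribution η x :=
  mem_contactDistribution.mpr fun i ↦ S.η_f x i u

theorem η_Q (x : M) (i : Fin s) (u : TangentSpace I x) : η i x (Q x u) = η i x u := by
  rw [S.η_eq, ← S.Q_selfAdjoint, S.Q_ξ, S.η_eq]

theorem eq_zero_of_f {x : M} {u : TangentSpace I x} (hu : u ∈ contactDistribution η x)
    (h : f x u = 0) : u = 0 := by
  have h1 := S.f_sq x u
  simp_rw [mem_contactDistribution.mp hu] at h1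
  apply (S.Q_nonsingular x).1
  simpa [h] using h1

theorem exists_f_eq {x : M} {u : TangentSpace I x} (hu : u ∈ contactDistribution η x) :
    ∃ v, f x v = u := by
  obtain ⟨v, rfl⟩ := (S.Q_nonsingular x).2 u
  refine ⟨-f x v, ?_⟩
  rw [map_neg, S.f_sq]
  simp_rw [mem_contactDistribution, S.η_Q] at hu
  simp [hu]

/-- A vector is determined by its components. -/
theorem sub_mem (x : M) (u : TangentSpace I x) :
    u - ∑ i, η i x u • ξ i x ∈ contactDistribution η x := by
  rw [mem_contactDistribution]
  intro j
  simp [map_sum, S.η_ξ]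

theorem induction_on {x : M} {p : TangentSpace I x → Prop} (u : TangentSpace I x)
    (hadd : ∀ u v, p u → p v → p (u + v)) (hsmul : ∀ (c : ℝ) u, p u → p (c • u))
    (hξ : ∀ i, p (ξ i x)) (hD : ∀ u ∈ contactDistribution η x, p u) : p u := by
  have h : ∀ t : Finset (Fin s), p (∑ i ∈ t, η i x u • ξ i x) := by
    intro t
    induction t using Finset.induction_on with
    | empty => simpa using hD 0 (zero_mem _)
    | insert a t ha ih =>
      rw [Finset.sum_insert ha]
      exact hadd _ _ (hsmul _ _ (hξ a)) ih
  have := hadd _ _ (hD _ (S.sub_mem x u)) (h Finset.univ)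
  simpa using this

/-- The characteristic fields as smooth fields. -/
def Ξ (i : Fin s) : Field I M := ⟨ξ i, S.smooth_ξ i⟩

theorem app_Ξ (i : Fin s) : S.smooth_f.app (S.Ξ i) = 0 := by
  ext x
  exact S.f_ξ x i

theorem met_app_skew (X Y : Field I M) :
    met g (S.smooth_f.app X) Y = -met g X (S.smooth_f.app Y) := by
  ext x
  exact S.f_skew x _ _

end IsWeakMetricFStructure

theorem nab_fsmul (X Y : Field I M) (φ : Fn I M) :
    nab g X (fsmul φ Y) = fsmul (der X φ) Y + fsmul φ (nab g X Y) := by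
  ext x
  have h := (leviCivita g).isCovariantDerivativeOnUniv.leibniz (Y.mdiffAt x) (φ.mdiffAt x)
  have h2 := congrArg (fun L ↦ L (X x)) h
  refine h2.trans ?_
  rw [add_comm]
  rfl

/-- The hypotheses on a weak nearly `C`-structure under which the structure is rigid. -/
structure IsRigidNearlyC (n : ℕ)
    (g : ContMDiffRiemannianMetric I ∞ E (fun x : M ↦ TangentSpace I x))
    (f Q : Π x : M, TangentSpace I x →L[ℝ] TangentSpace I x)
    (ξ : Fin s → Π x : M, TangentSpace I x)
    (η : Fin s → Π x : M, TangentSpace I x →L[ℝ] ℝ) : Prop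
    extends IsWeakNearlyCStructure n g f Q ξ η where
  bracket : ∀ i j x, VectorField.mlieBracket I (ξ i) (ξ j) x = 0
  nabla_ξ : ∀ i j x u, g.inner x (leviCivita g (ξ i) x u) (ξ j x) = 0
  nabla_Q : ∀ x u, ∀ v ∈ contactDistribution η x, nablaEnd g Q x u v = 0
  uniform : IsUniformCoframe η

namespace IsRigidNearlyC

variable (S : IsRigidNearlyC n g f Q ξ η)

include S

theorem h_mem (x : M) (i : Fin s) (u : TangentSpace I x) :
    leviCivita g (ξ i) x u ∈ contactDistribution η x := by
  rw [S.mem_iff]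
  intro j
  rw [g.symm, S.nabla_ξ]

theorem P_skew (X Y : Field I M) :
    nab g X (S.smooth_f.app Y) - S.smooth_f.app (nab g X Y) =
      -(nab g Y (S.smooth_f.app X) - S.smooth_f.app (nab g Y X)) := by
  ext x
  have h := S.nabla_f x (X x) (Y x)
  rw [nablaEnd_apply_field g S.smooth_f, nablaEnd_apply_field g S.smooth_f] at h
  exact eq_neg_of_add_eq_zero_left h

/-- The nearly condition makes f(∇_{ξᵢ}ξⱼ) skew in i, j, while commuting fields make it symmetric.
So it vanishes, and f is injective on D, where ∇_{ξᵢ}ξⱼ lies. -/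
theorem nab_Ξ_Ξ (i j : Fin s) : nab g (S.Ξ i) (S.Ξ j) = 0 := by
  have h := S.P_skew (S.Ξ i) (S.Ξ j)
  have hb : brk (S.Ξ i) (S.Ξ j) = 0 := by
    ext x
    exact S.bracket i j x
  rw [brk_eq g, sub_eq_zero] at hb
  rw [S.app_Ξ, S.app_Ξ, ← hb, map_zero, map_zero] at h
  ext x
  apply S.eq_zero_of_f (S.h_mem x j _)
  have h' := congrArg (fun V : Field I M ↦ V x) h
  simp only [zero_sub, neg_neg] at h'
  change -(f x (nab g (S.Ξ i) (S.Ξ j) x)) = f x (nab g (S.Ξ i) (S.Ξ j) x) at h'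
  have h2 := add_eq_zero_iff_eq_neg.mpr h'.symm
  rw [← two_smul ℝ] at h2
  exact (smul_eq_zero.mp h2).resolve_left two_ne_zero

theorem h_ξ (x : M) (i j : Fin s) : leviCivita g (ξ i) x (ξ j x) = 0 :=
  congrArg (fun V : Field I M ↦ V x) (S.nab_Ξ_Ξ j i)

/-- `∇_ξ f = f ∘ ∇ξ`. -/
theorem P_Ξ (i : Fin s) (X : Field I M) :
    nab g (S.Ξ i) (S.smooth_f.app X) - S.smooth_f.app (nab g (S.Ξ i) X) =
      S.smooth_f.app (nab g X (S.Ξ i)) := by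
  rw [S.P_skew, S.app_Ξ, map_zero]
  abel

theorem nablaEnd_ξ (x : M) (i : Fin s) (u : TangentSpace I x) :
    nablaEnd g f x (ξ i x) u = f x (leviCivita g (ξ i) x u) := by
  obtain ⟨X, rfl⟩ := exists_field_apply_eq u
  have h := nablaEnd_apply_field g S.smooth_f (S.Ξ i) X x
  rw [S.P_Ξ] at h
  exact h

/-- `∇_X f` is skew-symmetric. -/
theorem met_P_skew (X Y Z : Field I M) :
    met g (nab g X (S.smooth_f.app Y) - S.smooth_f.app (nab g X Y)) Z =
      -met g Y (nab g X (S.smooth_f.app Z) - S.smooth_f.app (nab g X Z)) := by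
  have h := congrArg (der X) (S.met_app_skew Y Z)
  rw [map_neg, der_met, der_met, S.met_app_skew Y] at h
  rw [map_sub, map_sub, AddMonoidHom.sub_apply, S.met_app_skew]
  linear_combination h

theorem metric_nablaEnd_skew (x : M) (u v w : TangentSpace I x) :
    g.inner x (nablaEnd g f x u v) w = -g.inner x v (nablaEnd g f x u w) := by
  obtain ⟨X, rfl⟩ := exists_field_apply_eq u
  obtain ⟨Y, rfl⟩ := exists_field_apply_eq v
  obtain ⟨Z, rfl⟩ := exists_field_apply_eq w
  rw [nablaEnd_apply_field g S.smooth_f, nablaEnd_apply_field g S.smooth_f]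
  exact congrArg (fun φ : Fn I M ↦ φ x) (S.met_P_skew X Y Z)

/-- fh equals ∇_ξ f, and any covariant derivative of a skew tensor is skew. -/
theorem fh_skew (x : M) (i : Fin s) (u v : TangentSpace I x) :
    g.inner x (f x (leviCivita g (ξ i) x u)) v = -g.inner x u (f x (leviCivita g (ξ i) x v)) := by
  rw [← S.nablaEnd_ξ, ← S.nablaEnd_ξ, S.metric_nablaEnd_skew]

/-- The derivative of the identity `f² = -Q + ∑ ηⁱ ⊗ ξᵢ`. -/
theorem nablaEnd_f_sq {x : M} (u : TangentSpace I x) {v : TangentSpace I x}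
    (hv : v ∈ contactDistribution η x) :
    nablaEnd g f x u (f x v) + f x (nablaEnd g f x u v) =
      ∑ i, g.inner x (leviCivita g (ξ i) x u) v • ξ i x := by
  obtain ⟨X, rfl⟩ := exists_field_apply_eq u
  obtain ⟨Y, rfl⟩ := exists_field_apply_eq v
  have hQ := S.nabla_Q x (X x) (Y x) hv
  rw [nablaEnd_apply_field g S.smooth_Q] at hQ
  have hsq : ∀ Z, S.smooth_f.app (S.smooth_f.app Z) =
      -S.smooth_Q.app Z + ∑ i, fsmul (met g (S.Ξ i) Z) (S.Ξ i) := by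
    intro Z
    ext x
    have h := S.f_sq x (Z x)
    simp_rw [S.η_eq] at h
    refine h.trans ?_
    rw [ContMDiffSection.coe_add, Pi.add_apply]
    congr 1
    rw [Field.sum_apply]
    rfl
  have h1 : nablaEnd g f x (X x) (f x (Y x)) = _ :=
    nablaEnd_apply_field g S.smooth_f X (S.smooth_f.app Y) x
  rw [h1, nablaEnd_apply_field g S.smooth_f X Y]
  change ((nab g X (S.smooth_f.app (S.smooth_f.app Y))
    - S.smooth_f.app (nab g X (S.smooth_f.app Y)))
    + S.smooth_f.app (nab g X (S.smooth_f.app Y) - S.smooth_f.app (nab g X Y))) x = _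
  rw [map_sub, sub_add_sub_cancel, hsq, hsq, map_add, map_neg, map_sum]
  simp_rw [nab_fsmul, der_met]
  -- Y lies in D only at x, so its ηⁱ-components may be dropped only after differentiation.
  have h0 : ∀ i, met g (S.Ξ i) Y x = 0 := fun i ↦ (S.mem_iff x (Y x)).mp hv i
  have h2 : -nab g X (S.smooth_Q.app Y) + ∑ i, (fsmul (met g (nab g X (S.Ξ i)) Y
      + met g (S.Ξ i) (nab g X Y)) (S.Ξ i) + fsmul (met g (S.Ξ i) Y) (nab g X (S.Ξ i)))
      - (-S.smooth_Q.app (nab g X Y) + ∑ i, fsmul (met g (S.Ξ i) (nab g X Y)) (S.Ξ i))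
      = -(nab g X (S.smooth_Q.app Y) - S.smooth_Q.app (nab g X Y))
        + ∑ i, (fsmul (met g (nab g X (S.Ξ i)) Y) (S.Ξ i)
          + fsmul (met g (S.Ξ i) Y) (nab g X (S.Ξ i))) := by
    have h3 : ∀ i, fsmul (met g (nab g X (S.Ξ i)) Y + met g (S.Ξ i) (nab g X Y)) (S.Ξ i)
        = fsmul (met g (nab g X (S.Ξ i)) Y) (S.Ξ i)
          + fsmul (met g (S.Ξ i) (nab g X Y)) (S.Ξ i) := by
      intro i
      ext x
      exact add_smul _ _ _
    simp_rw [h3, Finset.sum_add_distrib]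
    abel
  rw [h2, ContMDiffSection.coe_add, Pi.add_apply, ContMDiffSection.coe_neg, Pi.neg_apply, hQ,
    neg_zero, zero_add, Field.sum_apply]
  refine Finset.sum_congr rfl fun i _ ↦ ?_
  change met g (nab g X (S.Ξ i)) Y x • ξ i x + met g (S.Ξ i) Y x • nab g X (S.Ξ i) x = _
  rw [h0, zero_smul, add_zero]
  rfl

/-- `∇ξ` anticommutes with `f`. -/
theorem h_f (x : M) (i : Fin s) (u : TangentSpace I x) :
    leviCivita g (ξ i) x (f x u) = -f x (leviCivita g (ξ i) x u) := by
  refine S.induction_on u (p := fun u ↦ leviCivita g (ξ i) x (f x u)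
    = -f x (leviCivita g (ξ i) x u)) ?_ ?_ ?_ ?_
  · intro u v hu hv
    simp only [map_add, hu, hv, neg_add]
  · intro c u hu
    simp only [map_smul, hu, smul_neg]
  · intro j
    rw [S.f_ξ, S.h_ξ, map_zero, map_zero, neg_zero]
  · intro u hu
    -- Along ξᵢ the right-hand side vanishes because ∇_ξ ξ = 0, and ∇_ξ f = fh turns the left-hand
    -- side into f(hfu + fhu).
    have h := S.nablaEnd_f_sq (ξ i x) hu
    simp_rw [S.h_ξ, S.nablaEnd_ξ] at h
    rw [← map_add] at h
    simp only [map_zero, zero_apply, zero_smul, Finset.sum_const_zero] at h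
    exact eq_neg_of_add_eq_zero_left
      (S.eq_zero_of_f (add_mem (S.h_mem x i _) (S.f_mem x _)) h)

/-- On D write v = fw; skewness of f and of fh, with hf = -fh, gives skewness of h. -/
theorem h_skew (x : M) (i : Fin s) (u v : TangentSpace I x) :
    g.inner x (leviCivita g (ξ i) x u) v = -g.inner x u (leviCivita g (ξ i) x v) := by
  refine S.induction_on v (p := fun v ↦ g.inner x (leviCivita g (ξ i) x u) v
    = -g.inner x u (leviCivita g (ξ i) x v)) ?_ ?_ ?_ ?_
  · intro v w hv hw
    simp only [map_add, hv, hw, neg_add]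
  · intro c v hv
    simp only [map_smul, hv, smul_eq_mul, mul_neg]
  · intro j
    rw [S.nabla_ξ, S.h_ξ, map_zero, neg_zero]
  · intro v hv
    obtain ⟨w, rfl⟩ := S.exists_f_eq hv
    have h1 := S.fh_skew x i u w
    rw [S.f_skew] at h1
    rw [S.h_f, map_neg, neg_neg]
    linarith

theorem isKilling (i : Fin s) : IsKilling g (ξ i) := by
  intro x u v
  rw [S.h_skew, g.symm x _ u]
  ring

theorem met_nab_Ξ (i : Fin s) (X Y : Field I M) :
    met g (nab g X (S.Ξ i)) Y + met g (nab g Y (S.Ξ i)) X = 0 := by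
  ext x
  exact S.isKilling i x (X x) (Y x)

theorem extDeriv_η (x : M) (i : Fin s) (u v : TangentSpace I x) :
    extDerivForm (η i) x u v = 2 * g.inner x (leviCivita g (ξ i) x u) v := by
  obtain ⟨X, rfl⟩ := exists_field_apply_eq u
  obtain ⟨Y, rfl⟩ := exists_field_apply_eq v
  rw [extDerivForm_apply (S.smooth_η i) (X.mdiffAt x) (Y.mdiffAt x)]
  simp_rw [S.η_eq]
  change (der X (met g (S.Ξ i) Y) - der Y (met g (S.Ξ i) X) - met g (S.Ξ i) (brk X Y)) x = _
  have h := S.met_nab_Ξ i X Y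
  rw [brk_eq g, der_met, der_met, map_sub]
  have : met g (nab g X (S.Ξ i)) Y + met g (S.Ξ i) (nab g X Y) - (met g (nab g Y (S.Ξ i)) X
      + met g (S.Ξ i) (nab g Y X)) - (met g (S.Ξ i) (nab g X Y) - met g (S.Ξ i) (nab g Y X))
      = met g (nab g X (S.Ξ i)) Y + met g (nab g X (S.Ξ i)) Y := by
    linear_combination -h
  rw [this, two_mul]
  rfl

theorem h_eq (x : M) (i j : Fin s) (u : TangentSpace I x) :
    leviCivita g (ξ i) x u = leviCivita g (ξ j) x u := by
  refine metric_nondegenerate g fun w ↦ ?_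
  have h := S.uniform.2 i j x u w
  rw [S.extDeriv_η, S.extDeriv_η] at h
  linarith

/-- dηⁱ is twice the form g(hu,v), so its nondegeneracy on D is injectivity of h there. -/
theorem eq_zero_of_h {x : M} (i : Fin s) {u : TangentSpace I x}
    (hu : u ∈ contactDistribution η x) (h : leviCivita g (ξ i) x u = 0) : u = 0 := by
  obtain ⟨R, hR⟩ := S.uniform.1
  refine hR.nondegenerate i x u hu fun v _ ↦ ?_
  rw [S.extDeriv_η, h]
  simp

theorem exists_h_eq {x : M} (i : Fin s) {u : TangentSpace I x}
    (hu : u ∈ contactDistribution η x) :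
    ∃ v ∈ contactDistribution η x, leviCivita g (ξ i) x v = u := by
  let L : contactDistribution η x →ₗ[ℝ] contactDistribution η x :=
    (leviCivita g (ξ i) x).toLinearMap.restrict fun v _ ↦ S.h_mem x i v
  have hL : Function.Injective L := by
    rw [← LinearMap.ker_eq_bot, LinearMap.ker_eq_bot']
    intro v hv
    exact Subtype.ext (S.eq_zero_of_h i v.2 (congrArg Subtype.val hv))
  obtain ⟨v, hv⟩ := LinearMap.injective_iff_surjective.mp hL ⟨u, hu⟩
  exact ⟨v, v.2, congrArg Subtype.val hv⟩

/-- Differentiate g(QY,ξ) = g(Y,ξ) along X: as Q is parallel on D, only g(QY, hX) = g(Y, hX) is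
left. Since h maps onto D, this yields Q = id. -/
theorem Q_h (x : M) (i : Fin s) (u : TangentSpace I x) :
    Q x (leviCivita g (ξ i) x u) = leviCivita g (ξ i) x u := by
  have key : ∀ v ∈ contactDistribution η x,
      g.inner x v (Q x (leviCivita g (ξ i) x u) - leviCivita g (ξ i) x u) = 0 := by
    intro v hv
    obtain ⟨X, rfl⟩ := exists_field_apply_eq u
    obtain ⟨Y, rfl⟩ := exists_field_apply_eq v
    have hQ := S.nabla_Q x (X x) (Y x) hv
    rw [nablaEnd_apply_field g S.smooth_Q] at hQ
    have hs : ∀ Z, met g (S.smooth_Q.app Z) (S.Ξ i) = met g Z (S.Ξ i) := by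
      intro Z
      ext x
      change g.inner x (Q x (Z x)) (ξ i x) = g.inner x (Z x) (ξ i x)
      rw [S.Q_selfAdjoint, S.Q_ξ]
    have h := congrArg (der X) (hs Y)
    rw [der_met, der_met, ← hs (nab g X Y)] at h
    have h' := congrArg (fun φ : Fn I M ↦ φ x) h
    change g.inner x (nab g X (S.smooth_Q.app Y) x) (ξ i x)
        + g.inner x (Q x (Y x)) (nab g X (S.Ξ i) x)
      = g.inner x (S.smooth_Q.app (nab g X Y) x) (ξ i x) + g.inner x (Y x) (nab g X (S.Ξ i) x) at h'
    have e : nab g X (S.smooth_Q.app Y) x = S.smooth_Q.app (nab g X Y) x := sub_eq_zero.mp hQ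
    rw [e, S.Q_selfAdjoint] at h'
    change g.inner x (Y x) (Q x (nab g X (S.Ξ i) x) - nab g X (S.Ξ i) x) = 0
    rw [map_sub]
    linarith
  refine sub_eq_zero.mp (eq_zero_of_metric_self (g := g) (key _ (sub_mem ?_ (S.h_mem x i u))))
  have := S.h_mem x i u
  rw [mem_contactDistribution] at this ⊢
  intro j
  rw [S.η_Q, this]

theorem Q_eq (hs : 0 < s) (x : M) (u : TangentSpace I x) : Q x u = u := by
  refine S.induction_on u (p := fun u ↦ Q x u = u) ?_ ?_ (S.Q_ξ x) ?_
  · intro u v hu hv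
    rw [map_add, hu, hv]
  · intro c u hu
    rw [map_smul, hu]
  · intro u hu
    obtain ⟨v, -, rfl⟩ := S.exists_h_eq ⟨0, hs⟩ hu
    exact S.Q_h x _ v

theorem f_f (hs : 0 < s) {x : M} {u : TangentSpace I x} (hu : u ∈ contactDistribution η x) :
    f x (f x u) = -u := by
  rw [S.f_sq, S.Q_eq hs]
  simp [mem_contactDistribution.mp hu]

end IsRigidNearlyC

end NearlyC

/-! ### Vanishing of ∇f on the contact distribution -/

noncomputable section NablaF

set_option linter.unusedSectionVars false

/-- The algebraic core of the computation of `∇f`: here `B(u, v, w) = g((∇_{hu} f)v, w)`,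
`a(u, v, w) = g((∇_u h)v, w)` and `J` is the restriction of `f` to the contact distribution. -/
theorem eq_zero_of_skew_relations {V : Type*} [AddCommGroup V] {B a : V → V → V → ℝ} {J : V → V}
    (hJ : ∀ u, J (J u) = -u) (hB : ∀ u v w, B u v (-w) = -B u v w)
    (ha : ∀ u v w, a u v (-w) = -a u v w) (B_skew : ∀ u v w, B u v w = -B u w v)
    (BJ₁ : ∀ u v w, B (J u) v w = -B u (J v) w) (BJ₂ : ∀ u v w, B u (J v) w = B u v (J w))
    (a_skew : ∀ u v w, a u v w = -a u w v)
    (a_cyclic : ∀ u v w, a u v w + a v w u + a w u v = 0)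
    (h₁ : ∀ u v w, a u (J v) w - a u v (J w) = B w u v + B v u w)
    (h₂ : ∀ u v w, a u v (J w) + a v u (J w) = -(B u v w + B v u w)) (u v w : V) :
    B u v w = 0 := by
  have h₃ : ∀ u v w, a u v w + a v u w = B u v (J w) + B v u (J w) := by
    intro u v w
    have h := h₂ u v (J w)
    rw [hJ, ha, ha] at h
    linarith
  -- The part of a symmetric in u, v is known from `h₃`; skewness in v, w and the cyclic identity
  -- then determine a completely.
  have h₄ : ∀ u v w, 3 * a u v w = 2 * B u v (J w) + B v u (J w) - B w u (J v) := by
    intro u v w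
    have e := B_skew u w (J v)
    rw [BJ₂] at e
    linarith [h₃ u v w, h₃ u w v, a_skew u w v, a_cyclic u v w, a_skew v w u]
  -- Substitute the formula for a into `h₁`.
  have h₅ : ∀ u v w, B v u w + B w u v = 0 := by
    intro u v w
    have e₁ := h₄ u (J v) w
    have e₂ := h₄ u v (J w)
    rw [BJ₂, hJ, hJ, hB, hB, BJ₁, BJ₂, hJ, hB] at e₁
    rw [hJ, hB, hB, BJ₁, BJ₂, hJ, hB] at e₂
    linarith [h₁ u v w]
  have h₆ : ∀ u v w, B u v w = -B v u w := by
    intro u v w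
    linarith [B_skew u v w, h₅ w u v, B_skew v w u, B_skew v u w]
  -- B is now totally skew. Moving J from the first slot to the last changes the sign by `BJ₁` and
  -- `BJ₂`, but does not change it when u and v are swapped first.
  have h₇ : ∀ u v w, B u v (J w) = 0 := by
    intro u v w
    have e₁ := h₆ u v (J w)
    have e₂ := h₆ (J u) v w
    have e₃ := BJ₁ u v w
    rw [BJ₂] at e₃
    rw [BJ₂ v u w] at e₂
    linarith
  have h := h₇ u v (J w)
  rw [hJ, hB] at h
  linarith

variable {E : Type*} [NormedAddCommGroup E] [NormedSpace ℝ E] [FiniteDimensional ℝ E]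
  {H : Type*} [TopologicalSpace H] {I : ModelWithCorners ℝ E H}
  {M : Type*} [TopologicalSpace M] [ChartedSpace H M] [IsManifold I ∞ M] [T2Space M]
  {g : ContMDiffRiemannianMetric I ∞ E (fun x : M ↦ TangentSpace I x)}
  {n s : ℕ} {f Q : Π x : M, TangentSpace I x →L[ℝ] TangentSpace I x}
  {ξ : Fin s → Π x : M, TangentSpace I x} {η : Fin s → Π x : M, TangentSpace I x →L[ℝ] ℝ}

theorem nablaEnd_add_left (A : Π x : M, TangentSpace I x →L[ℝ] TangentSpace I x) (x : M)
    (u v w : TangentSpace I x) :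
    nablaEnd g A x (u + v) w = nablaEnd g A x u w + nablaEnd g A x v w := by
  simp only [nablaEnd, map_add]
  abel

theorem nablaEnd_smul_left (A : Π x : M, TangentSpace I x →L[ℝ] TangentSpace I x) (x : M)
    (c : ℝ) (u w : TangentSpace I x) : nablaEnd g A x (c • u) w = c • nablaEnd g A x u w := by
  simp only [nablaEnd, map_smul, smul_sub]

theorem nablaEnd_neg_left (A : Π x : M, TangentSpace I x →L[ℝ] TangentSpace I x) (x : M)
    (u w : TangentSpace I x) : nablaEnd g A x (-u) w = -nablaEnd g A x u w := by
  rw [← neg_one_smul ℝ, nablaEnd_smul_left, neg_one_smul]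

theorem three_smul_cancel {X Y : Field I M} (h : X + X + X = Y + Y + Y) : X = Y := by
  ext x
  have h1 : X x + X x + X x = Y x + Y x + Y x := congrArg (fun V : Field I M ↦ V x) h
  have h2 : ∀ a : TangentSpace I x, a + a + a = (3 : ℝ) • a := fun a ↦ by module
  rw [h2, h2] at h1
  exact smul_right_injective _ (three_ne_zero' ℝ) h1

namespace IsRigidNearlyC

variable (S : IsRigidNearlyC n g f Q ξ η)

include S

theorem app_nab_Ξ (i : Fin s) (X : Field I M) :
    nab g (S.smooth_f.app X) (S.Ξ i) = -S.smooth_f.app (nab g X (S.Ξ i)) := by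
  ext x
  exact S.h_f x i (X x)

/-- The covariant derivative of hf + fh = 0. -/
theorem nab_h_app (i : Fin s) (X Y : Field I M) :
    (nab g X (nab g (S.smooth_f.app Y) (S.Ξ i)) - nab g (nab g X (S.smooth_f.app Y)) (S.Ξ i)) +
      S.smooth_f.app (nab g X (nab g Y (S.Ξ i)) - nab g (nab g X Y) (S.Ξ i)) +
      nab g (nab g X (S.smooth_f.app Y) - S.smooth_f.app (nab g X Y)) (S.Ξ i) +
      (nab g X (S.smooth_f.app (nab g Y (S.Ξ i))) - S.smooth_f.app (nab g X (nab g Y (S.Ξ i))))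
      = 0 := by
  simp only [map_sub, AddMonoidHom.sub_apply, S.app_nab_Ξ, map_neg]
  abel

/-- Combines the Ricci identity for f in the directions X, ξ with ∇_ξ f = fh and the derivative of
hf + fh = 0. Symmetrizing in X and Y removes the terms that the nearly condition makes skew. -/
theorem app_nab_h_symm (i : Fin s) (X Y : Field I M) :
    S.smooth_f.app ((nab g X (nab g Y (S.Ξ i)) - nab g (nab g X Y) (S.Ξ i)) +
      (nab g Y (nab g X (S.Ξ i)) - nab g (nab g Y X) (S.Ξ i))) =
    (nab g (nab g X (S.Ξ i)) (S.smooth_f.app Y) - S.smooth_f.app (nab g (nab g X (S.Ξ i)) Y)) +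
    (nab g (nab g Y (S.Ξ i)) (S.smooth_f.app X) - S.smooth_f.app (nab g (nab g Y (S.Ξ i)) X)) := by
  have hc := fun X Y ↦ nab_nab_killing g (S.met_nab_Ξ i) X Y
  let F := S.smooth_f.app
  let P : Field I M → Field I M → Field I M := fun X Y ↦ nab g X (F Y) - F (nab g X Y)
  let Ξ := S.Ξ i
  let A : Field I M → Field I M → Field I M := fun X Y ↦ nab g X (nab g Y Ξ) - nab g (nab g X Y) Ξ
  have hP : ∀ X Y, P X Y = -P Y X := S.P_skew
  have hPsub : ∀ X Y Z, P (X - Y) Z = P X Z - P Y Z := by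
    intro X Y Z
    simp only [P, map_sub, AddMonoidHom.sub_apply]
    abel
  have hPΞ : ∀ X, P Ξ X = F (nab g X Ξ) := S.P_Ξ i
  -- The commutator of R_{X,ξ} with f, since ∇h is R_{X,ξ} by the Killing equation.
  have e1 : ∀ X Y, A X (F Y) - F (A X Y) = nab g X (P Ξ Y) + P X (nab g Ξ Y) - nab g Ξ (P X Y)
      - P Ξ (nab g X Y) - P (nab g X Ξ) Y + P (nab g Ξ X) Y := by
    intro X Y
    have h1 : A X (F Y) = curv g X Ξ (F Y) := hc X (F Y)
    have h2 : A X Y = curv g X Ξ Y := hc X Y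
    rw [h1, h2, curv_apply, curv_apply, brk_eq g]
    simp only [P, map_sub, AddMonoidHom.sub_apply]
    abel
  have e2 : ∀ X Y, nab g X (P Ξ Y) - P Ξ (nab g X Y) = P X (nab g Y Ξ) + F (A X Y) := by
    intro X Y
    simp only [hPΞ, P, A, map_sub]
    abel
  have e3 : ∀ X Y, A X (F Y) = -F (A X Y) - nab g (P X Y) Ξ - P X (nab g Y Ξ) := by
    intro X Y
    have h := S.nab_h_app i X Y
    change A X (F Y) + F (A X Y) + nab g (P X Y) Ξ + P X (nab g Y Ξ) = 0 at h
    rw [← sub_eq_zero, ← h]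
    abel
  have e4 : ∀ X Y, F (A X Y) + F (A X Y) + F (A X Y) = -nab g (P X Y) Ξ
      - (P X (nab g Y Ξ) + P X (nab g Y Ξ)) - P X (nab g Ξ Y) + nab g Ξ (P X Y)
      + P (nab g X Ξ) Y - P (nab g Ξ X) Y := by
    intro X Y
    have h := e1 X Y
    rw [e3, eq_add_of_sub_eq (e2 X Y), ← sub_eq_zero] at h
    rw [← sub_eq_zero, ← neg_eq_zero, ← h]
    abel
  change F (A X Y + A Y X) = P (nab g X Ξ) Y + P (nab g Y Ξ) X
  apply three_smul_cancel
  have a1 := e4 X Y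
  have a2 := e4 Y X
  rw [hP Y X, hP Y (nab g X Ξ), hP Y (nab g Ξ X), hP (nab g Ξ Y) X, hP (nab g Y Ξ) X] at a2
  rw [hP (nab g Y Ξ) X, map_add]
  have : F (A X Y) + F (A Y X) + (F (A X Y) + F (A Y X)) + (F (A X Y) + F (A Y X))
      = (F (A X Y) + F (A X Y) + F (A X Y)) + (F (A Y X) + F (A Y X) + F (A Y X)) := by abel
  rw [this, a1, a2]
  simp only [map_neg, AddMonoidHom.neg_apply]
  abel

/-- `g((∇_u f) v, w) = 0` on the contact distribution. -/
theorem metric_nablaEnd_eq_zero (hs : 0 < s) {x : M} {u v w : TangentSpace I x}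
    (hu : u ∈ contactDistribution η x) (hv : v ∈ contactDistribution η x)
    (hw : w ∈ contactDistribution η x) : g.inner x (nablaEnd g f x u v) w = 0 := by
  let i : Fin s := ⟨0, hs⟩
  let h := leviCivita g (ξ i)
  have hh : IsSmoothEnd h := isSmoothEnd_leviCivita g (S.Ξ i)
  have hP : ∀ u v, nablaEnd g f x u v = -nablaEnd g f x v u :=
    fun u v ↦ eq_neg_of_add_eq_zero_left (S.nabla_f x u v)
  have hF := S.metric_nablaEnd_skew x
  have hA : ∀ X Y : Field I M, nablaEnd g h x (X x) (Y x) =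
      (nab g X (nab g Y (S.Ξ i)) - nab g (nab g X Y) (S.Ξ i)) x := fun X Y ↦
    nablaEnd_apply_field g hh X Y x
  have hA' : ∀ X Y : Field I M, nablaEnd g h x (X x) (Y x) = curv g X (S.Ξ i) Y x := fun X Y ↦ by
    rw [hA, nab_nab_killing g (S.met_nab_Ξ i)]
  have hPf : ∀ X Y : Field I M, nablaEnd g f x (X x) (Y x) =
      (nab g X (S.smooth_f.app Y) - S.smooth_f.app (nab g X Y)) x :=
    fun X Y ↦ nablaEnd_apply_field g S.smooth_f X Y x
  let D := contactDistribution η x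
  let J : D → D := fun u ↦ ⟨f x u, S.f_mem x u⟩
  let B : D → D → D → ℝ := fun u v w ↦ g.inner x (nablaEnd g f x (h x u) v) w
  let a : D → D → D → ℝ := fun u v w ↦ g.inner x (nablaEnd g h x u v) w
  -- ∇(f²) takes D into the span of the ξⱼ, which pairs to zero with D.
  have f2 : ∀ (u : TangentSpace I x) (v w : D),
      g.inner x (nablaEnd g f x u (f x v)) w = g.inner x (nablaEnd g f x u v) (f x w) := by
    intro u v w
    have e := congrArg (fun z ↦ g.inner x z w) (S.nablaEnd_f_sq u v.2)
    have e0 : ∀ j, g.inner x (ξ j x) w = 0 := (S.mem_iff x w).mp w.2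
    simp only [map_add, add_apply, map_sum, sum_apply, map_smul,
      smul_apply, e0, smul_zero, Finset.sum_const_zero, S.f_skew] at e
    linarith
  have key : ∀ u v w, B u v w = 0 := by
    refine eq_zero_of_skew_relations (a := a) (J := J) ?_ ?_ ?_ ?_ ?_ ?_ ?_ ?_ ?_ ?_
    · intro u
      exact Subtype.ext (S.f_f hs u.2)
    · intro u v w
      simp [B]
    · intro u v w
      simp [a]
    · intro u v w
      simp only [B]
      rw [hF, g.symm]
    · intro u v w
      -- After hf = -fh, total skewness of g((∇_u f)v, w) allows f to pass from the direction of
      -- differentiation to the argument.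
      have e : h x (f x u) = -f x (h x u) := S.h_f x i u
      have hm : h x u ∈ D := S.h_mem x i u
      have e₁ := f2 v w ⟨_, hm⟩
      have e₂ := f2 (h x u) v w
      have e₃ := hF v (h x u) (f x w)
      rw [hP, map_neg, neg_apply, g.symm x (h x u)] at e₃
      simp only [B, J]
      rw [e, nablaEnd_neg_left, map_neg, neg_apply, hP (f x _), map_neg, neg_apply,
        neg_neg, hF, g.symm]
      linarith
    · intro u v w
      exact f2 _ v w
    · intro u v w
      obtain ⟨X, hX⟩ := exists_field_apply_eq (u : TangentSpace I x)
      obtain ⟨Y, hY⟩ := exists_field_apply_eq (v : TangentSpace I x)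
      obtain ⟨Z, hZ⟩ := exists_field_apply_eq (w : TangentSpace I x)
      simp only [a]
      rw [← hX, ← hY, ← hZ, hA', hA']
      exact congrArg (fun φ : Fn I M ↦ φ x) (met_curv_skew g X (S.Ξ i) Y Z)
    · intro u v w
      obtain ⟨X, hX⟩ := exists_field_apply_eq (u : TangentSpace I x)
      obtain ⟨Y, hY⟩ := exists_field_apply_eq (v : TangentSpace I x)
      obtain ⟨Z, hZ⟩ := exists_field_apply_eq (w : TangentSpace I x)
      simp only [a]
      rw [← hX, ← hY, ← hZ, hA', hA', hA']
      have e := met_curv_bianchi g Y Z X (S.Ξ i)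
      rw [← met_curv_pair g X _ Y Z, ← met_curv_pair g Y _ Z X, ← met_curv_pair g Z _ X Y] at e
      exact congrArg (fun φ : Fn I M ↦ φ x) e
    · intro u v w
      obtain ⟨X, hX⟩ := exists_field_apply_eq (u : TangentSpace I x)
      obtain ⟨Y, hY⟩ := exists_field_apply_eq (v : TangentSpace I x)
      have e : nablaEnd g h x u (f x v) + f x (nablaEnd g h x u v) + h x (nablaEnd g f x u v)
          + nablaEnd g f x u (h x v) = 0 := by
        rw [← hX, ← hY]
        have e1 : nablaEnd g h x (X x) (f x (Y x)) = _ := hA X (S.smooth_f.app Y)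
        have e2 : nablaEnd g f x (X x) (h x (Y x)) = _ := hPf X (nab g Y (S.Ξ i))
        rw [e1, e2, hA, hPf]
        exact congrArg (fun V : Field I M ↦ V x) (S.nab_h_app i X Y)
      have e' := congrArg (fun z ↦ g.inner x z w) e
      simp only [map_add, add_apply, map_zero, zero_apply, S.f_skew] at e'
      have e3 : g.inner x (h x (nablaEnd g f x u v)) w = -g.inner x (nablaEnd g f x u v) (h x w) :=
        S.h_skew x i _ _
      have e4 : g.inner x (nablaEnd g f x u (h x v)) w = -B v u w := by
        rw [hP, map_neg, neg_apply]
      have e5 : g.inner x (nablaEnd g f x u v) (h x w) = B w u v := by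
        simp only [B]
        rw [hF, hP, map_neg, neg_neg, g.symm]
      simp only [a, J]
      linarith
    · intro u v w
      obtain ⟨X, hX⟩ := exists_field_apply_eq (u : TangentSpace I x)
      obtain ⟨Y, hY⟩ := exists_field_apply_eq (v : TangentSpace I x)
      have e : f x (nablaEnd g h x u v + nablaEnd g h x v u) =
          nablaEnd g f x (h x u) v + nablaEnd g f x (h x v) u := by
        rw [← hX, ← hY]
        have e1 : nablaEnd g f x (h x (X x)) (Y x) = _ := hPf (nab g X (S.Ξ i)) Y
        have e2 : nablaEnd g f x (h x (Y x)) (X x) = _ := hPf (nab g Y (S.Ξ i)) X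
        rw [e1, e2, hA, hA]
        exact congrArg (fun V : Field I M ↦ V x) (S.app_nab_h_symm i X Y)
      have e' := congrArg (fun z ↦ g.inner x z w) e
      simp only [map_add, add_apply, S.f_skew] at e'
      simp only [a, J, B]
      linarith
  -- B only sees directions of the form hu', but these exhaust D.
  obtain ⟨u', hu', rfl⟩ := S.exists_h_eq i hu
  exact key ⟨u', hu'⟩ ⟨v, hv⟩ ⟨w, hw⟩

end IsRigidNearlyC

end NablaF

/-! ### The closed 3-form ∇f and the dimension of the contact distribution -/

noncomputable section Dimension

set_option linter.unusedSectionVars false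

variable {E : Type*} [NormedAddCommGroup E] [NormedSpace ℝ E] [FiniteDimensional ℝ E]
  {H : Type*} [TopologicalSpace H] {I : ModelWithCorners ℝ E H}
  {M : Type*} [TopologicalSpace M] [ChartedSpace H M] [IsManifold I ∞ M] [T2Space M]
  {g : ContMDiffRiemannianMetric I ∞ E (fun x : M ↦ TangentSpace I x)}
  {n s : ℕ} {f Q : Π x : M, TangentSpace I x →L[ℝ] TangentSpace I x}
  {ξ : Fin s → Π x : M, TangentSpace I x} {η : Fin s → Π x : M, TangentSpace I x →L[ℝ] ℝ}

namespace IsRigidNearlyC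

variable (S : IsRigidNearlyC n g f Q ξ η)

include S

/-- `∇f` in terms of `ηⁱ` and the form `g(f∇_u ξ, v)`. -/
theorem metric_nablaEnd_eq (i : Fin s) (x : M) (u v w : TangentSpace I x) :
    g.inner x (nablaEnd g f x u v) w =
      (∑ j, η j x u) * g.inner x (f x (leviCivita g (ξ i) x v)) w +
      (∑ j, η j x v) * g.inner x (f x (leviCivita g (ξ i) x w)) u +
      (∑ j, η j x w) * g.inner x (f x (leviCivita g (ξ i) x u)) v := by
  have hs : 0 < s := i.pos
  let Ω : TangentSpace I x → TangentSpace I x → ℝ :=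
    fun u v ↦ g.inner x (f x (leviCivita g (ξ i) x u)) v
  have hΩ : ∀ u v, Ω u v = -Ω v u := fun u v ↦ by
    simp only [Ω]
    rw [S.fh_skew, g.symm]
  have hΩξ : ∀ j v, Ω (ξ j x) v = 0 := fun j v ↦ by simp [Ω, S.h_ξ]
  have hΩξ' : ∀ j v, Ω v (ξ j x) = 0 := fun j v ↦ by rw [hΩ, hΩξ, neg_zero]
  have hη : ∀ j, ∑ k, η k x (ξ j x) = 1 := fun j ↦ by simp [S.η_ξ]
  have hD : ∀ u ∈ contactDistribution η x, ∑ k, η k x u = 0 := fun u hu ↦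
    Finset.sum_eq_zero fun k _ ↦ mem_contactDistribution.mp hu k
  have hF := S.metric_nablaEnd_skew x
  have hP : ∀ u v, nablaEnd g f x u v = -nablaEnd g f x v u :=
    fun u v ↦ eq_neg_of_add_eq_zero_left (S.nabla_f x u v)
  -- By total skewness it suffices to know the form with one slot equal to some ξⱼ, and on D, where
  -- it vanishes.
  have hξ : ∀ j v w, g.inner x (nablaEnd g f x (ξ j x) v) w = Ω v w := fun j v w ↦ by
    rw [S.nablaEnd_ξ, S.h_eq x j i]
  change _ = (∑ j, η j x u) * Ω v w + (∑ j, η j x v) * Ω w u + (∑ j, η j x w) * Ω u v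
  have lin : ∀ (c : ℝ) (u u' v : TangentSpace I x), Ω (u + u') v = Ω u v + Ω u' v ∧
      Ω v (u + u') = Ω v u + Ω v u' ∧ Ω (c • u) v = c * Ω u v ∧ Ω v (c • u) = c * Ω v u := by
    intro c u u' v
    simp [Ω]
  refine S.induction_on u (p := fun u ↦ g.inner x (nablaEnd g f x u v) w =
    (∑ j, η j x u) * Ω v w + (∑ j, η j x v) * Ω w u + (∑ j, η j x w) * Ω u v) ?_ ?_ ?_ ?_
  · intro u u' h h'
    simp only [nablaEnd_add_left, map_add, add_apply, h, h', lin 0 u u',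
      Finset.sum_add_distrib]
    ring
  · intro c u h
    simp only [nablaEnd_smul_left, map_smul, smul_apply, h, lin c u u, smul_eq_mul,
      ← Finset.mul_sum]
    ring
  · intro j
    rw [hξ, hη, hΩξ, hΩξ']
    ring
  intro u hu
  refine S.induction_on v (p := fun v ↦ g.inner x (nablaEnd g f x u v) w =
    (∑ j, η j x u) * Ω v w + (∑ j, η j x v) * Ω w u + (∑ j, η j x w) * Ω u v) ?_ ?_ ?_ ?_
  · intro v v' h h'
    rw [hP, map_neg, neg_apply] at h h' ⊢
    simp only [nablaEnd_add_left, map_add, add_apply, lin 0 v v',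
      Finset.sum_add_distrib]
    linear_combination h + h'
  · intro c v h
    rw [hP, map_neg, neg_apply] at h ⊢
    simp only [nablaEnd_smul_left, map_smul, smul_apply, lin c v v, smul_eq_mul,
      ← Finset.mul_sum]
    linear_combination c * h
  · intro j
    rw [hP, map_neg, neg_apply, hξ, hη, hΩξ, hΩξ', hΩ u w]
    ring
  intro v hv
  refine S.induction_on w (p := fun w ↦ g.inner x (nablaEnd g f x u v) w =
    (∑ j, η j x u) * Ω v w + (∑ j, η j x v) * Ω w u + (∑ j, η j x w) * Ω u v) ?_ ?_ ?_ ?_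
  · intro w w' h h'
    simp only [map_add, h, h', lin 0 w w', Finset.sum_add_distrib]
    ring
  · intro c w h
    simp only [map_smul, h, lin c w w, smul_eq_mul, ← Finset.mul_sum]
    ring
  · intro j
    rw [hF, hP, map_neg, neg_neg, g.symm, hξ, hη, hΩξ, hΩξ']
    ring
  · intro w hw
    rw [S.metric_nablaEnd_eq_zero hs hu hv hw, hD u hu, hD v hv, hD w hw]
    ring

/-- The 3-form `g((∇_X f)Y, Z)`. -/
def dPhi (X Y Z : Field I M) : Fn I M :=
  met g (nab g X (S.smooth_f.app Y) - S.smooth_f.app (nab g X Y)) Z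

/-- The covariant derivative of `dPhi`. -/
def nabDPhi (W X Y Z : Field I M) : Fn I M :=
  der W (S.dPhi X Y Z) - S.dPhi (nab g W X) Y Z - S.dPhi X (nab g W Y) Z - S.dPhi X Y (nab g W Z)

theorem dPhi_swap₁ (X Y Z : Field I M) : S.dPhi X Y Z = -S.dPhi Y X Z := by
  rw [dPhi, S.P_skew]
  simp [dPhi]

theorem dPhi_swap₂ (X Y Z : Field I M) : S.dPhi X Y Z = -S.dPhi X Z Y := by
  rw [dPhi, S.met_P_skew, met_symm]
  rfl

theorem nabDPhi_swap₁ (W X Y Z : Field I M) : S.nabDPhi W X Y Z = -S.nabDPhi W Y X Z := by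
  unfold nabDPhi
  rw [S.dPhi_swap₁ X Y Z, S.dPhi_swap₁ (nab g W X), S.dPhi_swap₁ X (nab g W Y),
    S.dPhi_swap₁ X Y (nab g W Z), map_neg]
  ring

theorem nabDPhi_swap₂ (W X Y Z : Field I M) : S.nabDPhi W X Y Z = -S.nabDPhi W X Z Y := by
  unfold nabDPhi
  rw [S.dPhi_swap₂ X Y Z, S.dPhi_swap₂ (nab g W X), S.dPhi_swap₂ X (nab g W Y),
    S.dPhi_swap₂ X Y (nab g W Z), map_neg]
  ring

/-- The Ricci identity for `f`. -/
theorem nabDPhi_sub (W X Y Z : Field I M) :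
    S.nabDPhi W X Y Z - S.nabDPhi X W Y Z =
      met g (curv g W X (S.smooth_f.app Y)) Z + met g (curv g W X Y) (S.smooth_f.app Z) := by
  have h := S.met_app_skew (curv g W X Y) Z
  rw [eq_neg_iff_add_eq_zero, add_comm, ← eq_neg_iff_add_eq_zero] at h
  rw [h]
  simp only [nabDPhi, dPhi, der_met, curv_apply, brk_eq g, map_sub, AddMonoidHom.sub_apply]
  ring

/-- The 3-form `dPhi` is closed. -/
theorem nabDPhi_alternating (W X Y Z : Field I M) :
    S.nabDPhi W X Y Z - S.nabDPhi X W Y Z + S.nabDPhi Y W X Z - S.nabDPhi Z W X Y = 0 := by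
  have hr := S.nabDPhi_sub
  have s₁ := S.nabDPhi_swap₁
  have s₂ := S.nabDPhi_swap₂
  have b := met_curv_bianchi g
  have t := met_curv_skew g
  have l := met_curv_skew_left g
  let F := S.smooth_f.app
  have g₁ : S.nabDPhi Y Z W X = S.nabDPhi Y W X Z := by rw [s₁ Y Z W X, s₂ Y W Z X, neg_neg]
  have g₂ : S.nabDPhi Z Y W X = S.nabDPhi Z W X Y := by rw [s₁ Z Y W X, s₂ Z W Y X, neg_neg]
  have g₃ : S.nabDPhi W Y Z X = S.nabDPhi W X Y Z := by rw [s₂ W Y Z X, s₁ W Y X Z, neg_neg]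
  have g₄ : S.nabDPhi X Z W Y = S.nabDPhi X W Y Z := by rw [s₁ X Z W Y, s₂ X W Z Y, neg_neg]
  have g₅ : S.nabDPhi W Z X Y = S.nabDPhi W X Y Z := by rw [s₁ W Z X Y, s₂ W X Z Y, neg_neg]
  -- The alternating sum T is a sum of two Ricci identities in three ways, one for each splitting of
  -- the four fields into pairs. In the total 3T the curvature terms group into four Bianchi sums.
  have h₁ : S.nabDPhi W X Y Z - S.nabDPhi X W Y Z + S.nabDPhi Y W X Z - S.nabDPhi Z W X Y =
      met g (curv g W X (F Y)) Z + met g (curv g W X Y) (F Z) +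
      (met g (curv g Y Z (F W)) X + met g (curv g Y Z W) (F X)) := by
    rw [← hr, ← hr, g₁, g₂]
    ring
  have h₂ : S.nabDPhi W X Y Z - S.nabDPhi X W Y Z + S.nabDPhi Y W X Z - S.nabDPhi Z W X Y =
      met g (curv g W Y (F Z)) X + met g (curv g W Y Z) (F X) +
      (met g (curv g Z X (F W)) Y + met g (curv g Z X W) (F Y)) := by
    rw [← hr, ← hr, g₃, g₄, s₂ Y W Z X, s₁ Z X W Y]
    ring
  have h₃ : S.nabDPhi W X Y Z - S.nabDPhi X W Y Z + S.nabDPhi Y W X Z - S.nabDPhi Z W X Y =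
      met g (curv g W Z (F X)) Y + met g (curv g W Z X) (F Y) +
      (met g (curv g X Y (F W)) Z + met g (curv g X Y W) (F Z)) := by
    rw [← hr, ← hr, g₅, s₁ X Y W Z, s₁ Y X W Z]
    ring
  rw [t W X (F Y), t Y Z (F W), l W X Z] at h₁
  rw [t W Y (F Z), t Z X (F W), l W Y X] at h₂
  rw [t W Z (F X), t X Y (F W), l W Z Y] at h₃
  generalize S.nabDPhi W X Y Z - S.nabDPhi X W Y Z + S.nabDPhi Y W X Z - S.nabDPhi Z W X Y = T
    at h₁ h₂ h₃ ⊢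
  have h : T + T + T = 0 := by
    linear_combination h₁ + h₂ + h₃ - b X Y Z (F W) + b Y Z W (F X) + b X W Z (F Y)
      + b W X Y (F Z)
  ext x
  have hx : T x + T x + T x = 0 := congrArg (fun φ : Fn I M ↦ φ x) h
  change T x = 0
  linarith

/-- The value of `nabDPhi` on vectors of the contact distribution. -/
theorem nabDPhi_apply (i : Fin s) {x : M} (W X Y Z : Field I M)
    (hX : X x ∈ contactDistribution η x) (hY : Y x ∈ contactDistribution η x)
    (hZ : Z x ∈ contactDistribution η x) :
    S.nabDPhi W X Y Z x = s *
      (g.inner x (leviCivita g (ξ i) x (W x)) (X x) *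
        g.inner x (f x (leviCivita g (ξ i) x (Y x))) (Z x) +
      g.inner x (leviCivita g (ξ i) x (W x)) (Y x) *
        g.inner x (f x (leviCivita g (ξ i) x (Z x))) (X x) +
      g.inner x (leviCivita g (ξ i) x (W x)) (Z x) *
        g.inner x (f x (leviCivita g (ξ i) x (X x))) (Y x)) := by
  let Ξ : Field I M := ∑ j, S.Ξ j
  let Ω : Field I M → Field I M → Fn I M := fun X Y ↦ met g (S.smooth_f.app (nab g X (S.Ξ i))) Y
  have hΞ : ∀ (X : Field I M) (y : M), met g Ξ X y = ∑ j, η j y (X y) := by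
    intro X y
    simp_rw [met_apply, S.η_eq, Ξ, Field.sum_apply, map_sum, sum_apply]
    rfl
  have hF : ∀ X Y Z, S.dPhi X Y Z = met g Ξ X * Ω Y Z + met g Ξ Y * Ω Z X + met g Ξ Z * Ω X Y := by
    intro X Y Z
    ext y
    have h := S.metric_nablaEnd_eq i y (X y) (Y y) (Z y)
    rw [nablaEnd_apply_field g S.smooth_f, ← hΞ, ← hΞ, ← hΞ] at h
    exact h
  have h0 : ∀ X : Field I M, X x ∈ contactDistribution η x → met g Ξ X x = 0 := by
    intro X hX
    rw [hΞ]
    exact Finset.sum_eq_zero fun k _ ↦ mem_contactDistribution.mp hX k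
  have hn : ∀ X : Field I M,
      met g (nab g W Ξ) X x = s * g.inner x (leviCivita g (ξ i) x (W x)) (X x) := by
    intro X
    -- All ∇ξⱼ coincide, which is where the factor s comes from.
    have e : nab g W Ξ x = (s : ℝ) • leviCivita g (ξ i) x (W x) := by
      simp only [Ξ, map_sum, Field.sum_apply]
      refine (Finset.sum_congr rfl fun j _ ↦
        (S.h_eq x j i (W x) : nab g W (S.Ξ j) x = _)).trans ?_
      simp [Nat.cast_smul_eq_nsmul]
    rw [met_apply, e]
    simp
  -- Leibniz rule for (∑ ηʲ) ∧ Ω. The last three terms carry ∑ ηʲ at X, Y or Z and vanish at x, so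
  -- the derivative of Ω is not needed.
  have h : S.nabDPhi W X Y Z =
      met g (nab g W Ξ) X * Ω Y Z + met g (nab g W Ξ) Y * Ω Z X + met g (nab g W Ξ) Z * Ω X Y
      + met g Ξ X * (der W (Ω Y Z) - Ω (nab g W Y) Z - Ω Y (nab g W Z))
      + met g Ξ Y * (der W (Ω Z X) - Ω (nab g W Z) X - Ω Z (nab g W X))
      + met g Ξ Z * (der W (Ω X Y) - Ω (nab g W X) Y - Ω X (nab g W Y)) := by
    simp only [nabDPhi, hF, map_add, der_mul]
    rw [der_met g W Ξ X, der_met g W Ξ Y, der_met g W Ξ Z]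
    ring
  rw [h]
  change met g (nab g W Ξ) X x * Ω Y Z x + met g (nab g W Ξ) Y x * Ω Z X x
    + met g (nab g W Ξ) Z x * Ω X Y x + met g Ξ X x * _ + met g Ξ Y x * _ + met g Ξ Z x * _ = _
  rw [hn, hn, hn, h0 X hX, h0 Y hY, h0 Z hZ]
  simp only [Ω, met_apply, zero_mul, add_zero]
  change s * _ * g.inner x (f x (leviCivita g (ξ i) x (Y x))) (Z x)
    + s * _ * g.inner x (f x (leviCivita g (ξ i) x (Z x))) (X x)
    + s * _ * g.inner x (f x (leviCivita g (ξ i) x (X x))) (Y x) = _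
  ring

/-- The 2-forms `g(hu, v)` and `g(fhu, v)` on the contact distribution have vanishing wedge
product. -/
theorem wedge_eq_zero (i : Fin s) {x : M} {u v w z : TangentSpace I x}
    (hu : u ∈ contactDistribution η x) (hv : v ∈ contactDistribution η x)
    (hw : w ∈ contactDistribution η x) (hz : z ∈ contactDistribution η x) :
    g.inner x (leviCivita g (ξ i) x u) v * g.inner x (f x (leviCivita g (ξ i) x w)) z +
    g.inner x (leviCivita g (ξ i) x w) z * g.inner x (f x (leviCivita g (ξ i) x u)) v -
    g.inner x (leviCivita g (ξ i) x u) w * g.inner x (f x (leviCivita g (ξ i) x v)) z -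
    g.inner x (leviCivita g (ξ i) x v) z * g.inner x (f x (leviCivita g (ξ i) x u)) w +
    g.inner x (leviCivita g (ξ i) x v) w * g.inner x (f x (leviCivita g (ξ i) x u)) z +
    g.inner x (leviCivita g (ξ i) x u) z * g.inner x (f x (leviCivita g (ξ i) x v)) w = 0 := by
  obtain ⟨U, rfl⟩ := exists_field_apply_eq u
  obtain ⟨V, rfl⟩ := exists_field_apply_eq v
  obtain ⟨W, rfl⟩ := exists_field_apply_eq w
  obtain ⟨Z, rfl⟩ := exists_field_apply_eq z
  have h : S.nabDPhi U V W Z x - S.nabDPhi V U W Z x + S.nabDPhi W U V Z x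
      - S.nabDPhi Z U V W x = 0 :=
    congrArg (fun φ : Fn I M ↦ φ x) (S.nabDPhi_alternating U V W Z)
  rw [S.nabDPhi_apply i _ _ _ _ hv hw hz, S.nabDPhi_apply i _ _ _ _ hu hw hz,
    S.nabDPhi_apply i _ _ _ _ hu hv hz, S.nabDPhi_apply i _ _ _ _ hu hv hw] at h
  have hs : (s : ℝ) ≠ 0 := Nat.cast_ne_zero.mpr i.pos.ne'
  have a : ∀ a b, g.inner x (leviCivita g (ξ i) x a) b = -g.inner x (leviCivita g (ξ i) x b) a :=
    fun a b ↦ by rw [S.h_skew, g.symm]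
  have b : ∀ a b, g.inner x (f x (leviCivita g (ξ i) x a)) b =
      -g.inner x (f x (leviCivita g (ξ i) x b)) a := fun a b ↦ by rw [S.fh_skew, g.symm]
  rw [← mul_sub, ← mul_add, ← mul_sub] at h
  have h' := (mul_eq_zero.mp h).resolve_left hs
  rw [a (V x) (U x), a (W x) (U x), a (W x) (V x), a (Z x) (U x), a (Z x) (V x), a (Z x) (W x),
    b (Z x) (U x), b (Z x) (V x), b (W x) (U x)] at h'
  linarith

/-- The contact distribution has dimension at most 4. -/
theorem finrank_contactDistribution_le (i : Fin s) {x : M} {u : TangentSpace I x}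
    (hu : u ∈ contactDistribution η x) (hu0 : u ≠ 0) :
    Module.finrank ℝ (contactDistribution η x) ≤ 4 := by
  let h := leviCivita g (ξ i) x
  have hm : ∀ v, h v ∈ contactDistribution η x := S.h_mem x i
  have hhu : h u ≠ 0 := fun e ↦ hu0 (S.eq_zero_of_h i hu e)
  -- With this choice ω(u,v) = |hu|² ≠ 0, and Ω(u,v) = g(fhu,hu) = 0 because f is skew. Then ω ∧ Ω =
  -- 0, evaluated on u and v, solves for Ω with four terms.
  let v := h u
  let c := g.inner x (h u) v
  have hc : c ≠ 0 := (g.pos x _ hhu).ne'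
  have hc' : g.inner x (f x (h u)) v = 0 := by
    have e := S.f_skew x (h u) (h u)
    rw [g.symm x (h u) (f x (h u))] at e
    simp only [v]
    linarith
  let t : Finset (TangentSpace I x) := by
    classical exact {f x (h v), h v, f x (h u), h u}
  have hle : contactDistribution η x ≤ Submodule.span ℝ (t : Set (TangentSpace I x)) := by
    intro w hw
    have hfw : -f x w ∈ contactDistribution η x := neg_mem (S.f_mem x w)
    -- As f² = -id on D, solving hy = -fw gives fhy = w, so Ω(y,·) is the covector dual to w.
    obtain ⟨y, hy, hyw⟩ := S.exists_h_eq i hfw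
    have hfy : f x (h y) = w := by
      change f x (leviCivita g (ξ i) x y) = w
      rw [hyw, map_neg, S.f_f i.pos hw, neg_neg]
    have key : c • w = g.inner x (h u) y • f x (h v) + g.inner x (f x (h u)) y • h v
        - g.inner x (h v) y • f x (h u) - g.inner x (f x (h v)) y • h u := by
      have hd : c • w - (g.inner x (h u) y • f x (h v) + g.inner x (f x (h u)) y • h v
        - g.inner x (h v) y • f x (h u) - g.inner x (f x (h v)) y • h u)
        ∈ contactDistribution η x :=
        sub_mem (Submodule.smul_mem _ _ hw) (sub_mem (sub_mem (add_mem
          (Submodule.smul_mem _ _ (S.f_mem x _)) (Submodule.smul_mem _ _ (hm _)))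
          (Submodule.smul_mem _ _ (S.f_mem x _))) (Submodule.smul_mem _ _ (hm _)))
      have hz : ∀ z ∈ contactDistribution η x, g.inner x (c • w - (g.inner x (h u) y • f x (h v)
          + g.inner x (f x (h u)) y • h v - g.inner x (h v) y • f x (h u)
          - g.inner x (f x (h v)) y • h u)) z = 0 := by
        intro z hz
        have hwedge := S.wedge_eq_zero i hu (hm u) hy hz
        change c * g.inner x (f x (h y)) z + g.inner x (h y) z * g.inner x (f x (h u)) v -
          g.inner x (h u) y * g.inner x (f x (h v)) z -
          g.inner x (h v) z * g.inner x (f x (h u)) y +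
          g.inner x (h v) y * g.inner x (f x (h u)) z + g.inner x (h u) z * g.inner x (f x (h v)) y
          = 0 at hwedge
        rw [hfy, hc'] at hwedge
        simp only [map_sub, map_add, map_smul, sub_apply, add_apply, smul_apply, smul_eq_mul]
        linarith
      exact sub_eq_zero.mp (eq_zero_of_metric_self (g := g) (hz _ hd))
    have hmem : ∀ a ∈ t, a ∈ Submodule.span ℝ (t : Set (TangentSpace I x)) :=
      fun a ha ↦ Submodule.subset_span ha
    have : c • w ∈ Submodule.span ℝ (t : Set (TangentSpace I x)) := by
      rw [key]
      refine sub_mem (sub_mem (add_mem ?_ ?_) ?_) ?_ <;>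
        exact Submodule.smul_mem _ _ (hmem _ (by simp [t]))
    exact (Submodule.smul_mem_iff _ hc).mp this
  calc Module.finrank ℝ (contactDistribution η x)
      ≤ Module.finrank ℝ (Submodule.span ℝ (t : Set (TangentSpace I x))) :=
        Submodule.finrank_mono hle
    _ ≤ t.card := finrank_span_finset_le_card t
    _ ≤ 4 := by
      classical
      exact Finset.card_le_four

/-- f, h and fh are all skew, so u, fu and hu are mutually orthogonal; they are nonzero because f
and h are injective on D. Parity of dim D supplies the missing dimension. -/
theorem three_le_finrank_contactDistribution (i : Fin s) {x : M} {u : TangentSpace I x}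
    (hu : u ∈ contactDistribution η x) (hu0 : u ≠ 0) :
    3 ≤ Module.finrank ℝ (contactDistribution η x) := by
  let h := leviCivita g (ξ i) x
  let b : Fin 3 → contactDistribution η x := ![⟨u, hu⟩, ⟨f x u, S.f_mem x u⟩, ⟨h u, S.h_mem x i u⟩]
  have h1 : g.inner x u u ≠ 0 := (g.pos x _ hu0).ne'
  have h2 : g.inner x (f x u) (f x u) ≠ 0 :=
    (g.pos x _ fun e ↦ hu0 (S.eq_zero_of_f hu e)).ne'
  have h3 : g.inner x (h u) (h u) ≠ 0 :=
    (g.pos x _ fun e ↦ hu0 (S.eq_zero_of_h i hu e)).ne'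
  have e1 : g.inner x u (f x u) = 0 := by
    have := S.f_skew x u u
    rw [g.symm] at this
    linarith
  have e2 : g.inner x u (h u) = 0 := by
    have := S.h_skew x i u u
    rw [g.symm] at this
    change g.inner x u (leviCivita g (ξ i) x u) = 0
    linarith
  have e3 : g.inner x (f x u) (h u) = 0 := by
    have := S.fh_skew x i u u
    rw [g.symm] at this
    rw [S.f_skew, neg_eq_zero]
    change g.inner x u (f x (leviCivita g (ξ i) x u)) = 0
    linarith
  have hb : LinearIndependent ℝ b := by
    rw [Fintype.linearIndependent_iff]
    intro a ha
    have ha' : a 0 • u + a 1 • f x u + a 2 • h u = 0 := by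
      have := congrArg Subtype.val ha
      simpa [Fin.sum_univ_three, b] using this
    have k1 := congrArg (g.inner x u) ha'
    have k2 := congrArg (g.inner x (f x u)) ha'
    have k3 := congrArg (g.inner x (h u)) ha'
    simp only [map_add, map_smul, smul_eq_mul, map_zero, g.symm x (f x u) u, g.symm x (h u) u,
      g.symm x (h u) (f x u), e1, e2, e3, mul_zero, add_zero, zero_add, mul_eq_zero, h1, h2, h3,
      or_false] at k1 k2 k3
    intro j
    fin_cases j
    exacts [k1, k2, k3]
  simpa using hb.fintype_card_le_finrank

end IsRigidNearlyC

end Dimension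

/-! ### The value of n and the weak f-K-contact structure -/

noncomputable section ContactStructure

set_option linter.unusedSectionVars false

variable {E : Type*} [NormedAddCommGroup E] [NormedSpace ℝ E] [FiniteDimensional ℝ E]
  {H : Type*} [TopologicalSpace H] {I : ModelWithCorners ℝ E H}
  {M : Type*} [TopologicalSpace M] [ChartedSpace H M] [IsManifold I ∞ M] [T2Space M]
  {g : ContMDiffRiemannianMetric I ∞ E (fun x : M ↦ TangentSpace I x)}
  {n s : ℕ} {f Q : Π x : M, TangentSpace I x →L[ℝ] TangentSpace I x}
  {ξ : Fin s → Π x : M, TangentSpace I x} {η : Fin s → Π x : M, TangentSpace I x →L[ℝ] ℝ}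

theorem IsWeakMetricFStructure.finrank_contactDistribution
    (S : IsWeakMetricFStructure n g f Q ξ η) (x : M) :
    Module.finrank ℝ (contactDistribution η x) = 2 * n := by
  have h : contactDistribution η x = LinearMap.range (f x).toLinearMap := by
    ext u
    constructor
    · exact S.exists_f_eq
    · rintro ⟨v, rfl⟩
      exact S.f_mem x v
  rw [← S.f_rank x, h]

namespace IsRigidNearlyC

variable (S : IsRigidNearlyC n g f Q ξ η)

include S

theorem rank_eq_two [Nonempty M] (hn : 0 < n) (hs : 0 < s) : n = 2 := by
  obtain ⟨x⟩ := ‹Nonempty M›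
  have hd := S.finrank_contactDistribution x
  have : Nontrivial (contactDistribution η x) :=
    Module.nontrivial_of_finrank_pos (R := ℝ) (by omega)
  obtain ⟨u, hu⟩ := exists_ne (0 : contactDistribution η x)
  have hu0 : (u : TangentSpace I x) ≠ 0 := fun h ↦ hu (Subtype.ext h)
  have h₁ := S.three_le_finrank_contactDistribution ⟨0, hs⟩ u.2 hu0
  have h₂ := S.finrank_contactDistribution_le ⟨0, hs⟩ u.2 hu0
  omega

/-- The operator `u ↦ -∇_u(∇_u ξ) + ∑ ηʲ(u) ξⱼ`. -/
def contactQ (_ : IsRigidNearlyC n g f Q ξ η) (i : Fin s) (x : M) :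
    TangentSpace I x →L[ℝ] TangentSpace I x :=
  -((leviCivita g (ξ i) x).comp (leviCivita g (ξ i) x)) + ∑ j, (η j x).smulRight (ξ j x)

theorem contactQ_apply (i : Fin s) (x : M) (u : TangentSpace I x) :
    S.contactQ i x u =
      -leviCivita g (ξ i) x (leviCivita g (ξ i) x u) + ∑ j, η j x u • ξ j x := by
  simp [contactQ, sum_apply]

theorem isSmoothEnd_nabla_ξ (i : Fin s) : IsSmoothEnd (fun x ↦ -leviCivita g (ξ i) x) :=
  isSmoothEnd_of_apply_field fun X ↦ (-nab g X (S.Ξ i)).contMDiff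

theorem isSmoothEnd_contactQ (i : Fin s) : IsSmoothEnd (S.contactQ i) := by
  refine isSmoothEnd_of_apply_field fun X ↦ ?_
  have h : (fun x ↦ S.contactQ i x (X x)) =
      (-nab g (nab g X (S.Ξ i)) (S.Ξ i) + ∑ j, fsmul (met g (S.Ξ j) X) (S.Ξ j) : Field I M) := by
    funext x
    rw [S.contactQ_apply, ContMDiffSection.coe_add, Pi.add_apply, Field.sum_apply]
    simp_rw [S.η_eq]
    rfl
  rw [h]
  exact ContMDiffSection.contMDiff _

/-- Skewness of h rewrites -h² as a Gram form; symmetry and positive definiteness, hence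
invertibility, are read off from this. -/
theorem metric_contactQ (i : Fin s) (x : M) (u v : TangentSpace I x) :
    g.inner x u (S.contactQ i x v) =
      g.inner x (leviCivita g (ξ i) x u) (leviCivita g (ξ i) x v) + ∑ j, η j x u * η j x v := by
  rw [S.contactQ_apply, map_add, map_neg, S.h_skew x i u, map_sum]
  congr 1
  refine Finset.sum_congr rfl fun j _ ↦ ?_
  rw [map_smul, S.η_eq x j u, g.symm x u, smul_eq_mul, mul_comm]

theorem contactQ_selfAdjoint (i : Fin s) (x : M) (u v : TangentSpace I x) :
    g.inner x (S.contactQ i x u) v = g.inner x u (S.contactQ i x v) := by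
  rw [g.symm, S.metric_contactQ, S.metric_contactQ, g.symm]
  simp_rw [mul_comm]

theorem contactQ_bijective (i : Fin s) (x : M) : Function.Bijective (S.contactQ i x) := by
  have h : Function.Injective (S.contactQ i x).toLinearMap := by
    rw [← LinearMap.ker_eq_bot, LinearMap.ker_eq_bot']
    intro u hu
    have hu' : S.contactQ i x u = 0 := hu
    have h := S.metric_contactQ i x u u
    rw [hu', map_zero] at h
    have h₁ : 0 ≤ g.inner x (leviCivita g (ξ i) x u) (leviCivita g (ξ i) x u) := by
      by_cases h0 : leviCivita g (ξ i) x u = 0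
      · simp [h0]
      · exact (g.pos x _ h0).le
    have h₂ : 0 ≤ ∑ j, η j x u * η j x u := Finset.sum_nonneg fun j _ ↦ mul_self_nonneg _
    have h₃ : ∑ j, η j x u * η j x u = 0 := by linarith
    have h₄ : u ∈ contactDistribution η x := mem_contactDistribution.mpr fun j ↦
      mul_self_eq_zero.mp
        ((Finset.sum_eq_zero_iff_of_nonneg fun j _ ↦ mul_self_nonneg _).mp h₃ j (Finset.mem_univ j))
    exact S.eq_zero_of_h i h₄ (eq_zero_of_metric_self (g := g) (by linarith))
  exact ⟨h, LinearMap.injective_iff_surjective.mp h⟩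

/-- The Killing identity gives R_{u,ξ}ξ = ∇_u(∇_ξ ξ) - h(∇_u ξ), and ∇_ξ ξ = 0 leaves -h²u. The
index k is free because h is the same for every ξₖ. -/
theorem contactQ_eq_curvature (i k : Fin s) {x : M} {u : TangentSpace I x}
    (hu : u ∈ contactDistribution η x) :
    S.contactQ i x u = curvature g x u (ξ k x) (ξ k x) := by
  obtain ⟨X, rfl⟩ := exists_field_apply_eq u
  have h : curvature g x (X x) (ξ k x) (ξ k x) = curv g X (S.Ξ k) (S.Ξ k) x :=
    curvature_apply_field g X (S.Ξ k) (S.Ξ k) x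
  rw [h, ← nab_nab_killing g (S.met_nab_Ξ k), S.nab_Ξ_Ξ, map_zero, zero_sub, S.contactQ_apply]
  simp_rw [mem_contactDistribution.mp hu, S.h_eq x i k]
  simp
  rfl

/-- The tensors `-∇ξ` and `contactQ` form a weak `f`-K-contact structure. -/
theorem isWeakFKContactStructure (i : Fin s) :
    IsWeakFKContactStructure n g (fun x ↦ -leviCivita g (ξ i) x) (S.contactQ i) ξ η where
  smooth_f := S.isSmoothEnd_nabla_ξ i
  smooth_Q := S.isSmoothEnd_contactQ i
  smooth_ξ := S.smooth_ξ
  smooth_η := S.smooth_η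
  f_skew x u v := by
    simp only [neg_apply, map_neg]
    rw [S.h_skew]
  f_rank x := by
    have h : LinearMap.range (-leviCivita g (ξ i) x).toLinearMap = contactDistribution η x := by
      ext u
      constructor
      · rintro ⟨v, rfl⟩
        exact neg_mem (S.h_mem x i v)
      · intro hu
        obtain ⟨v, -, hv⟩ := S.exists_h_eq i (neg_mem hu)
        refine ⟨v, ?_⟩
        change -leviCivita g (ξ i) x v = u
        rw [hv, neg_neg]
    rw [← S.finrank_contactDistribution x, h]
  Q_selfAdjoint := S.contactQ_selfAdjoint i
  Q_nonsingular := S.contactQ_bijective i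
  ξ_orthonormal := S.ξ_orthonormal
  f_sq x u := by
    rw [S.contactQ_apply]
    simp
  η_ξ := S.η_ξ
  Q_ξ x j := by
    rw [S.contactQ_apply, S.h_ξ, map_zero, neg_zero, zero_add]
    simp [S.η_ξ]
  metric_f x u v := by
    rw [S.metric_contactQ]
    simp
  fundamental j x u v := by
    rw [S.extDeriv_η, S.h_eq x j i, S.h_skew]
    simp
  killing := S.isKilling

end IsRigidNearlyC

end ContactStructure

end WeakNearlyC

theorem mainTheorem2 (n s : ℕ) (hn : 0 < n) (hs : 0 < s)
    {M : Type*} [TopologicalSpace M] [T2Space M] [SecondCountableTopology M] [Nonempty M]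
    [ChartedSpace (EuclideanSpace ℝ (Fin (2 * n + s))) M] [IsManifold (𝓡 (2 * n + s)) ∞ M]
    (g : ContMDiffRiemannianMetric (𝓡 (2 * n + s)) ∞ (EuclideanSpace ℝ (Fin (2 * n + s)))
      (fun x : M ↦ TangentSpace (𝓡 (2 * n + s)) x))
    (f Q : Π x : M, TangentSpace (𝓡 (2 * n + s)) x →L[ℝ] TangentSpace (𝓡 (2 * n + s)) x)
    (ξ : Fin s → Π x : M, TangentSpace (𝓡 (2 * n + s)) x)
    (η : Fin s → Π x : M, TangentSpace (𝓡 (2 * n + s)) x →L[ℝ] ℝ)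
    (hM : WeakNearlyC.IsWeakNearlyCStructure n g f Q ξ η)
    (h_bracket : ∀ i j x, VectorField.mlieBracket (𝓡 (2 * n + s)) (ξ i) (ξ j) x = 0)
    (h_nabla_ξ : ∀ i j x u, g.inner x (WeakNearlyC.leviCivita g (ξ i) x u) (ξ j x) = 0)
    (h_nabla_Q : ∀ x u, ∀ v ∈ WeakNearlyC.contactDistribution η x,
      WeakNearlyC.nablaEnd g Q x u v = 0)
    (h_curv : ∀ x, ∀ u ∈ WeakNearlyC.contactDistribution η x,
      ∀ v ∈ WeakNearlyC.contactDistribution η x, ∀ w ∈ WeakNearlyC.contactDistribution η x,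
        WeakNearlyC.curvature g x (Q x u - u) v w ∈ WeakNearlyC.contactDistribution η x)
    (h_uniform : WeakNearlyC.IsUniformCoframe η) :
    n = 2 ∧
    (∀ x : M, Module.finrank ℝ (TangentSpace (𝓡 (2 * n + s)) x) = 4 + s) ∧
    ∃ f' Q' : Π x : M, TangentSpace (𝓡 (2 * n + s)) x →L[ℝ] TangentSpace (𝓡 (2 * n + s)) x,
      WeakNearlyC.IsWeakFKContactStructure n g f' Q' ξ η ∧
      (∀ i x u, f' x u = -WeakNearlyC.leviCivita g (ξ i) x u) ∧
      (∀ i x, ∀ u ∈ WeakNearlyC.contactDistribution η x,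
        Q' x u = WeakNearlyC.curvature g x u (ξ i x) (ξ i x)) := by
  have S : WeakNearlyC.IsRigidNearlyC n g f Q ξ η :=
    { hM with
      bracket := h_bracket
      nabla_ξ := h_nabla_ξ
      nabla_Q := h_nabla_Q
      uniform := h_uniform }
  have h2 : n = 2 := S.rank_eq_two hn hs
  refine ⟨h2, fun x ↦ ?_, fun x ↦ -WeakNearlyC.leviCivita g (ξ ⟨0, hs⟩) x, S.contactQ ⟨0, hs⟩,
    S.isWeakFKContactStructure ⟨0, hs⟩, fun i x u ↦ ?_, fun i x u hu ↦ ?_⟩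
  · change Module.finrank ℝ (EuclideanSpace ℝ (Fin (2 * n + s))) = 4 + s
    rw [finrank_euclideanSpace_fin, h2]
  · rw [neg_apply, S.h_eq x _ i]
  · exact S.contactQ_eq_curvature _ i hu
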